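/- Let $(\Sigma,\partial)$ be a differential field of characteristic zero with field of constants $\mathbf C$, and let $L=\partial^n+v_2\partial^{n-2}+\dots+v_n\in\Sigma[\partial]$ be a differential operator of order $n\ge 1$ in normal form. Let $\mathcal Z(L)$ be its centralizer in $\Sigma[\partial]$, a $\mathbf C[L]$-module, and let $\mathcal Z_m(L)$ be the set of its elements of order at most $m$. Assume that $L$ has level $M$, i.e. $M$ is the smallest integer with $\mathcal Z_M(L)\not\subseteq\mathbf C[L]$, and put $\rho=\gcd(n,M)$ and $d=n/\rho$. *Gelfand–Dickey systems.* For the formal operator $L_n=\partial^n+u_2\partial^{n-2}+\dots+u_n$ with differential indeterminates $U=\{u_2,\dots,u_n\}$ let $P_m=(L_n^{m/n})_+$ be the positive part of the $m$-th power of the monic $n$-th root of $L_n$ in $\mathbf C\{U\}((\partial^{-1}))$, and write $[P_m,L_n]=\sum_{k=0}^{n-2}H_{k,m}\partial^k$. Let $B_m$ and $\sigma_{k,m}$ be obtained from $P_m$ and $H_{k,m}$ by substituting $v_i$ for $u_i$. For a finite set $\mathcal{S}$ of orders with $0\in \mathcal S$ let $J^*_{m}(\mathcal S)=\{0,\dots,m-1\}\setminus\bigcup_{q\in\mathcal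 S}\{q+hn\mid h\ge 0\}$, and let $\mathrm{GD}^*_{n,m}(L)$ (for $\mathcal S$) be the linear system $\sigma_{k,m}+\sum_{j\in J^*_m(\mathcal S)}c_j\sigma_{k,j}=0$, $k=0,\dots,n-2$, in the unknowns $c_j$, $j\in J^*_m(\mathcal S)$, to be solved in $\mathbf C$. *Filtered basis.* A filtered basis of $\mathcal Z(L)$ is a basis $\{G_0=1,G_1,\dots,G_{r}\}$ of the $\mathbf C[L]$-module $\mathcal Z(L)$ whose orders $M_i$ satisfy $0=M_0<M_1<\dots<M_{r}$ and such that, for every $i\ge1$, $\mathcal Z_{M_i}(L)=\mathcal Z_{M_i-1}(L)\oplus\mathbf C\,G_i$, and, with $\mathcal S=\{M_0,\dots,M_{i-1}\}$, the system $\mathrm{GD}^*_{n,M_i}(L)$ has a unique constant solution $(c_j)$ and $G_i=B_{M_i}+\sum_{j\in J^*_{M_i}(\mathcal S)}c_jB_j$. *Algorithm Filtered\_basis* (input $L$, $M$). Start with the list $[1]$. For $m=M,\dots,(d-1)M$ in turn: if $m$ is not congruent modulo $n$ to the order of an operator already in the list, solve $\mathrm{GD}^*_{n,m}(L)$ in $\mathbf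 C$, with $\mathcal S$ the set of orders of the operators in the list; if a constant solution $(\xi_j)$ exists, append $B_m+\sum_{j\in J^*_m(\mathcal S)}\xi_jB_j$ to the list. Return the list. (The systems are solved by an arbitrary procedure that returns a constant solution whenever there is one.) *Maximal submodules of rank $\rho$.* An operator $G\in\mathcal Z(L)\setminus\{0\}$ is order minimal if its order is the smallest among the orders of all nonzero $Q\in\mathcal Z(L)$ with $\operatorname{ord}Q\equiv\operatorname{ord}G \pmod n$. A maximal submodule $\mathcal M_\rho$ of $\mathcal Z(L)$ of rank $\rho$ is a $\mathbf C[L]$-submodule that has a basis $G_0=1,G_1,\dots,G_{d-1}$ of operators which are order minimal in $\mathcal Z(L)$, with $\operatorname{ord}G_k\equiv k\rho\pmod n$. **Theorem.** 1. If $\rho=1$, then $\mathcal Z(L)$ has exactly one filtered basis, and the algorithm returns it. 2. If $\rho\ne1$, then the algorithm returns a basis of a $\mathbf C[L]$-submodule $\mathcal M$ of $\mathcal Z(L)$ that contains every maximal submodule of rank $\rho$, and at least one such submodule exists: $\mathcal M_\rho\subseteq\mathcal M\subseteq\mathcal Z(L)$. Moreover, if the set $\{Q\in\mathcal Z(L)\mid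 Q=0\text{ or }\rho\text{ divides }\operatorname{ord}Q\}$ is a $\mathbf C[L]$-submodule, then $\mathcal M$ contains it too. -/

import Mathlib

/-- The subring of constants of a differential ring. -/
def constants (R : Type*) [CommRing R] [Differential R] : Subring R where
  carrier := {c | Differential.deriv c = 0}
  mul_mem' := fun {a b} ha hb => by
    have ha' : Differential.deriv a = 0 := ha
    have hb' : Differential.deriv b = 0 := hb
    simp [Derivation.leibniz, ha', hb']
  one_mem' := by simp
  add_mem' := fun {a b} ha hb => by
    have ha' : Differential.deriv a = 0 := ha
    have hb' : Differential.deriv b = 0 := hb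
    simp [ha', hb']
  zero_mem' := by simp
  neg_mem' := fun {a} ha => by
    have ha' : Differential.deriv a = 0 := ha
    simp [ha']

/-- The `l`-th iterate of the derivation. -/
def iterDeriv {R : Type*} [CommRing R] [Differential R] (l : ℕ) : R →+ R where
  toFun := (fun a : R => Differential.deriv a)^[l]
  map_zero' := Function.iterate_fixed (map_zero _) l
  map_add' := fun a b => by
    induction l generalizing a b with
    | zero => rfl
    | succ l ih => simp only [Function.iterate_succ, Function.comp_apply, map_add, ih]

section IterDeriv
variable {R : Type*} [CommRing R] [Differential R]

theorem iterDeriv_zero (a : R) : iterDeriv 0 a = a := rfl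

theorem iterDeriv_add (l m : ℕ) (a : R) :
    iterDeriv (l + m) a = iterDeriv l (iterDeriv m a) :=
  Function.iterate_add_apply _ l m a

theorem iterDeriv_succ (l : ℕ) (a : R) :
    iterDeriv (l + 1) a = Differential.deriv (iterDeriv l a) := by
  rw [add_comm, iterDeriv_add]
  rfl

theorem iterDeriv_const {c : R} (hc : Differential.deriv c = 0) (l : ℕ) (hl : l ≠ 0) :
    iterDeriv l c = 0 := by
  obtain ⟨k, rfl⟩ := Nat.exists_eq_succ_of_ne_zero hl
  rw [Nat.succ_eq_add_one, iterDeriv_add k 1, iterDeriv_succ, iterDeriv_zero, hc, map_zero]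

theorem iterDeriv_mul (l : ℕ) (a b : R) :
    iterDeriv l (a * b) = ∑ e ∈ Finset.range (l + 1),
      (l.choose e : R) * (iterDeriv e a * iterDeriv (l - e) b) := by
  induction l with
  | zero => simp [iterDeriv_zero]
  | succ l ih =>
    rw [← Finset.Nat.sum_antidiagonal_eq_sum_range_succ
      (fun i j => ((l + 1).choose i : R) * (iterDeriv i a * iterDeriv j b)),
      Finset.sum_antidiagonal_choose_succ_mul (fun i j => iterDeriv i a * iterDeriv j b),
      iterDeriv_succ, ih,
      ← Finset.Nat.sum_antidiagonal_eq_sum_range_succ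
      (fun i j => (l.choose i : R) * (iterDeriv i a * iterDeriv j b)), map_sum,
      ← Finset.sum_add_distrib]
    refine Finset.sum_congr rfl fun p hp => ?_
    have hp' : p.1 + p.2 = l := by simpa using hp
    have h2 : l.choose p.2 = l.choose p.1 := by
      rw [← hp']; exact (Nat.choose_symm_add).symm
    simp only [Derivation.leibniz, smul_eq_mul, iterDeriv_succ, h2, Derivation.map_natCast]
    ring

end IterDeriv

theorem sum_Icc_eq_range {R : Type*} [AddCommMonoid R] (f : ℤ → R) (lo hi u : ℤ) (m : ℕ) (h1 : lo ≤ u) (h2 : u + m ≤ hi)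
    (h : ∀ s, s < u ∨ u + m < s → f s = 0) :
    ∑ s ∈ Finset.Icc lo hi, f s = ∑ t ∈ Finset.range (m + 1), f (u + t) := by
  classical
  have hinj : Set.InjOn (fun t : ℕ => u + (t : ℤ)) (Finset.range (m + 1)) := by
    intro x _ y _ hxy
    simpa using hxy
  rw [← Finset.sum_image (f := f) hinj]
  symm
  apply Finset.sum_subset
  · intro x hx
    simp only [Finset.mem_image, Finset.mem_range] at hx
    obtain ⟨t, ht, rfl⟩ := hx
    rw [Finset.mem_Icc]; omega
  · intro x _ hx
    apply h
    by_contra hc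
    apply hx
    simp only [Finset.mem_image, Finset.mem_range]
    exact ⟨(x - u).toNat, by omega, by omega⟩

/-- The formal pseudo-differential operators `∑_{i ≤ N} a_i ∂^i` with coefficients in `R`: the
elements of `R((∂⁻¹))`. -/
@[ext]
structure PseudoDiffOp (R : Type*) [CommRing R] [Differential R] where
  /-- the coefficient `a_i` of `∂^i` -/
  coeff : ℤ → R
  bounded' : ∃ N : ℤ, ∀ i > N, coeff i = 0

namespace PseudoDiffOp
variable {R : Type*} [CommRing R] [Differential R]

/-- `A` has order at most `m` (or is zero). -/
def OrderLE (A : PseudoDiffOp R) (m : ℤ) : Prop := ∀ i > m, A.coeff i = 0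

/-- `A` has order `m`; in particular it is not zero. -/
def HasOrder (A : PseudoDiffOp R) (m : ℤ) : Prop := A.coeff m ≠ 0 ∧ A.OrderLE m

instance : Zero (PseudoDiffOp R) := ⟨⟨fun _ => 0, 0, fun _ _ => rfl⟩⟩
instance : One (PseudoDiffOp R) := ⟨⟨fun i => if i = 0 then 1 else 0, 0, fun i hi => by
  simp [ne_of_gt hi]⟩⟩
instance : Add (PseudoDiffOp R) := ⟨fun A B => ⟨fun i => A.coeff i + B.coeff i, by
  obtain ⟨N, hN⟩ := A.bounded'
  obtain ⟨N', hN'⟩ := B.bounded'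
  exact ⟨max N N', fun i hi => by
    rw [hN i (lt_of_le_of_lt (le_max_left _ _) hi), hN' i (lt_of_le_of_lt (le_max_right _ _) hi),
      add_zero]⟩⟩⟩
instance : Neg (PseudoDiffOp R) := ⟨fun A => ⟨fun i => -A.coeff i, by
  obtain ⟨N, hN⟩ := A.bounded'
  exact ⟨N, fun i hi => by rw [hN i hi, neg_zero]⟩⟩⟩

theorem zero_coeff (i : ℤ) : (0 : PseudoDiffOp R).coeff i = 0 := rfl
theorem one_coeff (i : ℤ) : (1 : PseudoDiffOp R).coeff i = if i = 0 then 1 else 0 := rfl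
theorem add_coeff (A B : PseudoDiffOp R) (i : ℤ) :
    (A + B).coeff i = A.coeff i + B.coeff i := rfl
theorem neg_coeff (A : PseudoDiffOp R) (i : ℤ) : (-A).coeff i = -A.coeff i := rfl

/-- The coefficient of `∂^k` in `A * B`, from `(a ∂^i) (b ∂^j) = ∑_l (i choose l) a b^{(l)} ∂^{i+j-l}`. -/
noncomputable def mulCoeff (A B : PseudoDiffOp R) (k : ℤ) : R :=
  ∑ᶠ p : ℤ × ℕ, (Ring.choose p.1 p.2 : ℤ) • (A.coeff p.1 * iterDeriv p.2 (B.coeff (k - p.1 + p.2)))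

/-- The coefficient of `∂^k` in `(a ∂^i) (b ∂^j)`. -/
def term (k i j : ℤ) (a b : R) : R :=
  if k ≤ i + j then
    ((Ring.choose i (i + j - k).toNat : ℤ) : R) * (a * iterDeriv (i + j - k).toNat b) else 0

theorem mulCoeff_eq (A B : PseudoDiffOp R) (k : ℤ) {N N' : ℤ} (hA : A.OrderLE N)
    (hB : B.OrderLE N') (S T : Finset ℤ) (hS : Finset.Icc (k - N') N ⊆ S)
    (hT : Finset.Icc (k - N) N' ⊆ T) :
    mulCoeff A B k = ∑ i ∈ S, ∑ j ∈ T, term k i j (A.coeff i) (B.coeff j) := by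
  classical
  rw [← Finset.sum_product']
  unfold mulCoeff
  have key : ∀ p : ℤ × ℕ, (Ring.choose p.1 p.2 : ℤ) •
      (A.coeff p.1 * iterDeriv p.2 (B.coeff (k - p.1 + p.2))) ≠ 0 →
      p.1 ≤ N ∧ k - p.1 + p.2 ≤ N' := by
    intro p hp
    constructor
    · by_contra h
      exact hp (by rw [hA _ (not_le.1 h)]; simp)
    · by_contra h
      exact hp (by rw [hB _ (not_le.1 h)]; simp)
  set U : Finset (ℤ × ℤ) := (S ×ˢ T).filter (fun q => k ≤ q.1 + q.2)
  set e : ℤ × ℤ → ℤ × ℕ := fun q => (q.1, (q.1 + q.2 - k).toNat)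
  have hinj : Set.InjOn e U := by
    intro q hq q' hq' h
    have h1 : k ≤ q.1 + q.2 := (Finset.mem_filter.1 hq).2
    have h2 : k ≤ q'.1 + q'.2 := (Finset.mem_filter.1 hq').2
    simp only [e, Prod.mk.injEq] at h
    ext <;> omega
  rw [finsum_eq_sum_of_support_subset (s := U.image e), Finset.sum_image hinj,
    Finset.sum_filter]
  · refine Finset.sum_congr rfl fun q _ => ?_
    simp only [term, e]
    split_ifs with h
    · rw [zsmul_eq_mul]
      congr 4
      omega
    · rfl
  · intro p hp
    obtain ⟨h1, h2⟩ := key p hp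
    simp only [Finset.coe_image, Set.mem_image, Finset.mem_coe, U, Finset.mem_filter,
      Finset.mem_product, e]
    refine ⟨(p.1, k - p.1 + p.2), ⟨⟨hS ?_, hT ?_⟩, by dsimp only; omega⟩, ?_⟩
    · rw [Finset.mem_Icc]; omega
    · rw [Finset.mem_Icc]; omega
    · ext
      · rfl
      · dsimp only; omega

theorem mulCoeff_of_lt (A B : PseudoDiffOp R) (k : ℤ) {N N' : ℤ} (hA : A.OrderLE N)
    (hB : B.OrderLE N') (h : N + N' < k) : mulCoeff A B k = 0 := by
  rw [mulCoeff_eq A B k hA hB (Finset.Icc (k - N') N) (Finset.Icc (k - N) N') subset_rfl subset_rfl]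
  rw [Finset.Icc_eq_empty (by omega)]
  simp

noncomputable instance : Mul (PseudoDiffOp R) := ⟨fun A B => ⟨mulCoeff A B, by
  obtain ⟨N, hN⟩ := A.bounded'
  obtain ⟨N', hN'⟩ := B.bounded'
  exact ⟨N + N', fun k hk => mulCoeff_of_lt A B k hN hN' hk⟩⟩⟩

theorem mul_coeff (A B : PseudoDiffOp R) (k : ℤ) : (A * B).coeff k = mulCoeff A B k := rfl

theorem OrderLE.mono {A : PseudoDiffOp R} {m m' : ℤ} (h : A.OrderLE m) (hm : m ≤ m') :
    A.OrderLE m' := fun i hi => h i (lt_of_le_of_lt hm hi)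

theorem OrderLE.mul {A B : PseudoDiffOp R} {m m' : ℤ} (h : A.OrderLE m) (h' : B.OrderLE m') :
    (A * B).OrderLE (m + m') := fun _ hi => mulCoeff_of_lt A B _ h h' hi

theorem OrderLE.add {A B : PseudoDiffOp R} {m : ℤ} (h : A.OrderLE m) (h' : B.OrderLE m) :
    (A + B).OrderLE m := fun i hi => by rw [add_coeff, h i hi, h' i hi, add_zero]

theorem exists_common_bound (A B C : PseudoDiffOp R) :
    ∃ N : ℤ, 0 ≤ N ∧ A.OrderLE N ∧ B.OrderLE N ∧ C.OrderLE N := by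
  obtain ⟨N₁, h₁⟩ := A.bounded'
  obtain ⟨N₂, h₂⟩ := B.bounded'
  obtain ⟨N₃, h₃⟩ := C.bounded'
  refine ⟨max 0 (max N₁ (max N₂ N₃)), le_max_left _ _, ?_, ?_, ?_⟩
  · exact OrderLE.mono h₁ (by simp)
  · exact OrderLE.mono h₂ (by simp)
  · exact OrderLE.mono h₃ (by simp)

theorem term_zero_left (k i j : ℤ) (b : R) : term k i j 0 b = 0 := by simp [term]
theorem term_zero_right (k i j : ℤ) (a : R) : term k i j a 0 = 0 := by simp [term]

theorem term_add_left (k i j : ℤ) (a a' b : R) :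
    term k i j (a + a') b = term k i j a b + term k i j a' b := by
  unfold term; split_ifs <;> ring

theorem term_add_right (k i j : ℤ) (a b b' : R) :
    term k i j a (b + b') = term k i j a b + term k i j a b' := by
  unfold term; split_ifs
  · rw [map_add]; ring
  · ring

theorem term_sum_left {ι : Type*} (s : Finset ι) (f : ι → R) (k i j : ℤ) (b : R) :
    term k i j (∑ x ∈ s, f x) b = ∑ x ∈ s, term k i j (f x) b :=
  map_sum (AddMonoidHom.mk' (fun a => term k i j a b) (fun a a' => term_add_left k i j a a' b)) f s

theorem term_sum_right {ι : Type*} (s : Finset ι) (f : ι → R) (k i j : ℤ) (a : R) :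
    term k i j a (∑ x ∈ s, f x) = ∑ x ∈ s, term k i j a (f x) :=
  map_sum (AddMonoidHom.mk' (fun b => term k i j a b) (fun b b' => term_add_right k i j a b b')) f s

theorem choose_identity (i j : ℤ) (e m : ℕ) (he : e ≤ m) :
    (Ring.choose i e * Ring.choose (i + j - e) (m - e) : ℤ) =
      ∑ t ∈ Finset.range (m + 1), if e ≤ t then
        Ring.choose i t * Ring.choose j (m - t) * (t.choose e : ℤ) else 0 := by
  have h1 : Ring.choose (i + j - e) (m - e) =
      ∑ p ∈ Finset.range (m - e + 1), Ring.choose (i - e) p * Ring.choose j (m - e - p) := by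
    rw [show i + j - (e : ℤ) = (i - e) + j by ring, Ring.add_choose_eq _ (Commute.all _ _),
      Finset.Nat.sum_antidiagonal_eq_sum_range_succ
        (fun p q => Ring.choose (i - e) p * Ring.choose j q)]
  rw [h1, Finset.mul_sum]
  have h2 : m + 1 = e + (m - e + 1) := by omega
  conv_rhs => rw [h2]
  rw [Finset.sum_range_add _ e (m - e + 1), Finset.sum_eq_zero (s := Finset.range e), zero_add]
  · refine Finset.sum_congr rfl fun p _ => ?_
    rw [if_pos (by omega)]
    have h3 := Ring.choose_smul_choose i (n := e + p) (k := e) (by omega)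
    rw [nsmul_eq_mul, show e + p - e = p by omega] at h3
    rw [show m - (e + p) = m - e - p by omega]
    linear_combination -(Ring.choose j (m - e - p)) * h3
  · intro t ht
    rw [if_neg (by have := Finset.mem_range.1 ht; omega)]

theorem term_assoc (k i j h lo hi : ℤ) (a b c : R) (h1 : lo ≤ k - h) (h2 : i + j ≤ hi)
    (h3 : lo ≤ k - i) (h4 : j + h ≤ hi) :
    ∑ s ∈ Finset.Icc lo hi, term k s h (term s i j a b) c =
      ∑ s ∈ Finset.Icc lo hi, term k i s a (term s j h b c) := by
  by_cases hm : i + j + h < k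
  · rw [Finset.sum_eq_zero, Finset.sum_eq_zero]
    · intro s _
      by_cases hs : s ≤ j + h
      · rw [term, if_neg (by omega)]
      · rw [term.eq_def s, if_neg hs, term_zero_right]
    · intro s _
      by_cases hs : s ≤ i + j
      · rw [term, if_neg (by omega)]
      · rw [term.eq_def s, if_neg hs, term_zero_left]
  obtain ⟨m, hm⟩ : ∃ m : ℕ, i + j + h - k = m := ⟨(i + j + h - k).toNat, by omega⟩
  rw [sum_Icc_eq_range _ lo hi (k - h) m h1 (by omega),
    sum_Icc_eq_range _ lo hi (k - i) m h3 (by omega)]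
  rotate_left
  · rintro s (hs | hs)
    · rw [term, if_neg (by omega)]
    · rw [term.eq_def s, if_neg (by omega), term_zero_right]
  · rintro s (hs | hs)
    · rw [term, if_neg (by omega)]
    · rw [term.eq_def s, if_neg (by omega), term_zero_left]
  have eL : ∀ t ∈ Finset.range (m + 1), term k (k - h + t) h (term (k - h + t) i j a b) c =
      ((Ring.choose i (m - t) * Ring.choose (i + j - (m - t : ℕ)) (m - (m - t)) : ℤ) : R) *
        (a * iterDeriv (m - t) b * iterDeriv (m - (m - t)) c) := by
    intro t ht
    have ht' := Finset.mem_range.1 ht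
    rw [term, if_pos (by omega), term, if_pos (by omega)]
    rw [show (k - h + t + h - k).toNat = m - (m - t) by omega,
      show (i + j - (k - h + t)).toNat = m - t by omega,
      show k - h + (t : ℤ) = i + j - (m - t : ℕ) by omega]
    push_cast
    ring
  rw [Finset.sum_congr rfl eL, Finset.sum_flip (fun e =>
    ((Ring.choose i e * Ring.choose (i + j - (e : ℕ)) (m - e) : ℤ) : R) *
        (a * iterDeriv e b * iterDeriv (m - e) c))]
  have eR : ∀ t ∈ Finset.range (m + 1), term k i (k - i + t) a (term (k - i + t) j h b c) =
      ∑ e ∈ Finset.range (m + 1), ((if e ≤ t then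
        Ring.choose i t * Ring.choose j (m - t) * (t.choose e : ℤ) else 0 : ℤ) : R) *
        (a * iterDeriv e b * iterDeriv (m - e) c) := by
    intro t ht
    have ht' := Finset.mem_range.1 ht
    rw [term, if_pos (by omega), term, if_pos (by omega)]
    rw [show (i + (k - i + t) - k).toNat = t by omega,
      show (j + h - (k - i + t)).toNat = m - t by omega,
      ← zsmul_eq_mul (b * _), map_zsmul, zsmul_eq_mul, iterDeriv_mul,
      ← Finset.sum_subset (Finset.range_subset_range.2 (show t + 1 ≤ m + 1 by omega)), Finset.mul_sum,
      Finset.mul_sum, Finset.mul_sum]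
    · refine Finset.sum_congr rfl fun e he => ?_
      have he' := Finset.mem_range.1 he
      rw [if_pos (by omega), ← iterDeriv_add, show t - e + (m - t) = m - e by omega]
      push_cast
      ring
    · intro e _ he
      have he' : ¬ e < t + 1 := fun hh => he (Finset.mem_range.2 hh)
      rw [if_neg (by omega)]
      simp
  rw [Finset.sum_congr rfl eR, Finset.sum_comm]
  refine Finset.sum_congr rfl fun e he => ?_
  have he' := Finset.mem_range.1 he
  rw [choose_identity i j e m (by omega), Int.cast_sum, Finset.sum_mul]

protected theorem mul_assoc' (A B C : PseudoDiffOp R) : A * B * C = A * (B * C) := by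
  ext k
  obtain ⟨N, hN, hA, hB, hC⟩ := exists_common_bound A B C
  set lo : ℤ := k - 4 * N - |k|
  set hi : ℤ := 4 * N + |k|
  have hk1 := neg_abs_le k
  have hk2 := le_abs_self k
  set S := Finset.Icc lo hi
  set T := Finset.Icc (lo - 4 * N) hi
  have hAB := OrderLE.mul hA hB
  have hBC := OrderLE.mul hB hC
  have hT : ∀ s ∈ S, ∀ x : ℤ, x ≤ N → Finset.Icc (s - x) N ⊆ T := by
    intro s hs x hx
    have := Finset.mem_Icc.1 hs
    apply Finset.Icc_subset_Icc <;> omega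
  rw [mul_coeff, mulCoeff_eq (A * B) C k hAB hC S T
      (Finset.Icc_subset_Icc (by omega) (by omega)) (Finset.Icc_subset_Icc (by omega) (by omega)),
    mul_coeff, mulCoeff_eq A (B * C) k hA hBC T S
      (Finset.Icc_subset_Icc (by omega) (by omega)) (Finset.Icc_subset_Icc (by omega) (by omega))]
  have e1 : ∀ s ∈ S, ∀ h ∈ T, term k s h ((A * B).coeff s) (C.coeff h) =
      ∑ i ∈ T, ∑ j ∈ T, term k s h (term s i j (A.coeff i) (B.coeff j)) (C.coeff h) := by
    intro s hs h _
    rw [mul_coeff, mulCoeff_eq A B s hA hB T T (hT s hs N le_rfl) (hT s hs N le_rfl),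
      term_sum_left]
    exact Finset.sum_congr rfl fun i _ => term_sum_left _ _ _ _ _ _
  have e2 : ∀ i ∈ T, ∀ s ∈ S, term k i s (A.coeff i) ((B * C).coeff s) =
      ∑ j ∈ T, ∑ h ∈ T, term k i s (A.coeff i) (term s j h (B.coeff j) (C.coeff h)) := by
    intro i _ s hs
    rw [mul_coeff, mulCoeff_eq B C s hB hC T T (hT s hs N le_rfl) (hT s hs N le_rfl),
      term_sum_right]
    exact Finset.sum_congr rfl fun i _ => term_sum_right _ _ _ _ _ _
  rw [Finset.sum_congr rfl fun s hs => Finset.sum_congr rfl fun h hh => e1 s hs h hh,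
    Finset.sum_congr rfl fun i hi => Finset.sum_congr rfl fun s hs => e2 i hi s hs]
  have l1 : ∑ s ∈ S, ∑ h ∈ T, ∑ i ∈ T, ∑ j ∈ T,
        term k s h (term s i j (A.coeff i) (B.coeff j)) (C.coeff h) =
      ∑ i ∈ T, ∑ j ∈ T, ∑ h ∈ T, ∑ s ∈ S,
        term k s h (term s i j (A.coeff i) (B.coeff j)) (C.coeff h) := by
    rw [Finset.sum_comm]
    rw [Finset.sum_congr rfl fun h _ => Finset.sum_comm]
    rw [Finset.sum_comm]
    refine Finset.sum_congr rfl fun i _ => ?_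
    rw [Finset.sum_congr rfl fun h _ => Finset.sum_comm]
    rw [Finset.sum_comm]
  have l2 : ∑ i ∈ T, ∑ s ∈ S, ∑ j ∈ T, ∑ h ∈ T,
        term k i s (A.coeff i) (term s j h (B.coeff j) (C.coeff h)) =
      ∑ i ∈ T, ∑ j ∈ T, ∑ h ∈ T, ∑ s ∈ S,
        term k i s (A.coeff i) (term s j h (B.coeff j) (C.coeff h)) := by
    refine Finset.sum_congr rfl fun i _ => ?_
    rw [Finset.sum_comm]
    refine Finset.sum_congr rfl fun h _ => ?_
    rw [Finset.sum_comm]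
  rw [l1, l2]
  refine Finset.sum_congr rfl fun i _ => Finset.sum_congr rfl fun j _ =>
    Finset.sum_congr rfl fun h _ => ?_
  by_cases hi' : N < i
  · rw [hA i hi']; simp only [term_zero_left]
  by_cases hj' : N < j
  · rw [hB j hj']; simp only [term_zero_left, term_zero_right]
  by_cases hh' : N < h
  · rw [hC h hh']; simp only [term_zero_right]
  apply term_assoc <;> omega

theorem mulCoeff_eq_of_le (A B : PseudoDiffOp R) (k N : ℤ) (hA : A.OrderLE N)
    (hB : B.OrderLE N) : (A * B).coeff k =
      ∑ i ∈ Finset.Icc (k - N) N, ∑ j ∈ Finset.Icc (k - N) N,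
        term k i j (A.coeff i) (B.coeff j) :=
  mulCoeff_eq A B k hA hB _ _ subset_rfl subset_rfl

noncomputable instance : Ring (PseudoDiffOp R) where
  add_assoc A B C := by ext i; simp only [add_coeff, add_assoc]
  zero_add A := by ext i; simp only [add_coeff, zero_coeff, zero_add]
  add_zero A := by ext i; simp only [add_coeff, zero_coeff, add_zero]
  add_comm A B := by ext i; simp only [add_coeff, add_comm]
  neg_add_cancel A := by ext i; simp only [add_coeff, neg_coeff, zero_coeff, neg_add_cancel]
  nsmul := nsmulRec
  zsmul := zsmulRec
  zero_mul A := by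
    ext k
    simp [mul_coeff, mulCoeff, zero_coeff]
  mul_zero A := by
    ext k
    simp [mul_coeff, mulCoeff, zero_coeff]
  left_distrib A B C := by
    ext k
    obtain ⟨N, _, hA, hB, hC⟩ := exists_common_bound A B C
    rw [add_coeff, mulCoeff_eq_of_le _ _ k N hA (hB.add hC), mulCoeff_eq_of_le _ _ k N hA hB,
      mulCoeff_eq_of_le _ _ k N hA hC]
    simp only [add_coeff, term_add_right, Finset.sum_add_distrib]
  right_distrib A B C := by
    ext k
    obtain ⟨N, _, hA, hB, hC⟩ := exists_common_bound A B C
    rw [add_coeff, mulCoeff_eq_of_le _ _ k N (hA.add hB) hC, mulCoeff_eq_of_le _ _ k N hA hC,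
      mulCoeff_eq_of_le _ _ k N hB hC]
    simp only [add_coeff, term_add_left, Finset.sum_add_distrib]
  one_mul A := by
    ext k
    rw [mul_coeff, mulCoeff, finsum_eq_single _ ((0 : ℤ), 0)]
    · simp [one_coeff, iterDeriv_zero]
    · rintro ⟨i, l⟩ h
      by_cases hi : i = 0
      · subst hi
        have hl : l ≠ 0 := fun hl => h (by rw [hl])
        simp [Ring.choose_zero_pos ℤ (Nat.pos_of_ne_zero hl)]
      · simp [one_coeff, hi]
  mul_one A := by
    ext k
    rw [mul_coeff, mulCoeff, finsum_eq_single _ (k, 0)]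
    · simp [one_coeff, iterDeriv_zero]
    · rintro ⟨i, l⟩ h
      rw [one_coeff]
      by_cases hl : l = 0
      · subst hl
        have hi : i ≠ k := fun hi => h (by rw [hi])
        rw [if_neg (by dsimp only; push_cast; omega)]
        simp
      · split_ifs
        · simp [iterDeriv_const (R := R) (c := 1) (by simp) l hl]
        · simp
  mul_assoc := PseudoDiffOp.mul_assoc'

theorem sub_coeff (A B : PseudoDiffOp R) (i : ℤ) :
    (A - B).coeff i = A.coeff i - B.coeff i := by
  rw [sub_eq_add_neg, add_coeff, neg_coeff, sub_eq_add_neg]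

/-- The element `a ∈ R` as an operator of order zero. -/
def single (a : R) : PseudoDiffOp R :=
  ⟨fun i => if i = 0 then a else 0, 0, fun i hi => by simp [ne_of_gt hi]⟩

theorem single_mul_coeff (a : R) (A : PseudoDiffOp R) (k : ℤ) :
    (single a * A).coeff k = a * A.coeff k := by
  rw [mul_coeff, mulCoeff, finsum_eq_single _ ((0 : ℤ), 0)]
  · simp [single, iterDeriv_zero]
  · rintro ⟨i, l⟩ h
    by_cases hi : i = 0
    · subst hi
      have hl : l ≠ 0 := fun hl => h (by rw [hl])
      simp [Ring.choose_zero_pos ℤ (Nat.pos_of_ne_zero hl)]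
    · simp [single, hi]

theorem mul_single_coeff (a : R) (ha : Differential.deriv a = 0) (A : PseudoDiffOp R) (k : ℤ) :
    (A * single a).coeff k = a * A.coeff k := by
  rw [mul_coeff, mulCoeff, finsum_eq_single _ (k, 0)]
  · simp [single, iterDeriv_zero, mul_comm]
  · rintro ⟨i, l⟩ h
    dsimp only [single]
    by_cases hl : l = 0
    · subst hl
      have hi : i ≠ k := fun hi => h (by rw [hi])
      rw [if_neg (by push_cast; omega)]
      simp
    · split_ifs
      · simp [iterDeriv_const ha l hl]
      · simp

/-- `R((∂⁻¹))` is an algebra over the ring of constants. -/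
noncomputable instance : Algebra (constants R) (PseudoDiffOp R) where
  smul c A := single (c : R) * A
  algebraMap :=
    { toFun := fun c => single (c : R)
      map_one' := rfl
      map_zero' := by ext i; simp [single, zero_coeff]
      map_add' := fun a b => by
        ext i
        simp only [single, add_coeff, Subring.coe_add]
        split_ifs <;> simp
      map_mul' := fun a b => by
        ext i
        rw [single_mul_coeff]
        simp [single] }
  commutes' c A := by
    ext k
    exact (single_mul_coeff _ A k).trans (mul_single_coeff _ c.2 A k).symm
  smul_def' _ _ := rfl

theorem smul_coeff (c : constants R) (A : PseudoDiffOp R) (k : ℤ) :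
    (c • A).coeff k = c * A.coeff k := single_mul_coeff _ A k

theorem algebraMap_coeff (c : constants R) (k : ℤ) :
    (algebraMap (constants R) (PseudoDiffOp R) c).coeff k = if k = 0 then (c : R) else 0 := rfl

end PseudoDiffOp

section DiffOp
variable (R : Type*) [CommRing R] [Differential R]

/-- The ring `R[∂]` of differential operators: the operators in `R((∂⁻¹))` all of whose
coefficients at negative powers of `∂` vanish. -/
def DiffOp : Subalgebra (constants R) (PseudoDiffOp R) where
  carrier := {A | ∀ i < 0, A.coeff i = 0}
  mul_mem' := fun {A B} hA hB k hk => by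
    rw [PseudoDiffOp.mul_coeff, PseudoDiffOp.mulCoeff]
    refine finsum_eq_zero_of_forall_eq_zero ?_
    rintro ⟨i, l⟩
    by_cases hi : i < 0
    · simp [hA i hi]
    by_cases hj : k - i + l < 0
    · simp [hB _ hj]
    obtain ⟨a, rfl⟩ := Int.eq_ofNat_of_zero_le (not_lt.1 hi)
    have : Ring.choose ((a : ℕ) : ℤ) l = 0 := by
      rw [Ring.choose_natCast, Nat.choose_eq_zero_of_lt (by omega)]
      rfl
    simp [this]
  add_mem' := fun {A B} hA hB k hk => by
    rw [PseudoDiffOp.add_coeff, hA k hk, hB k hk, add_zero]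
  algebraMap_mem' := fun c k hk => by
    rw [PseudoDiffOp.algebraMap_coeff, if_neg (ne_of_lt hk)]

end DiffOp

namespace DiffOp
variable {R : Type*} [CommRing R] [Differential R]

/-- The positive part `A₊` of a pseudo-differential operator. -/
def posPart (A : PseudoDiffOp R) : DiffOp R :=
  ⟨⟨fun i => if 0 ≤ i then A.coeff i else 0, by
    obtain ⟨N, hN⟩ := A.bounded'
    exact ⟨N, fun i hi => by rw [hN i hi, ite_self]⟩⟩,
    fun i hi => if_neg (not_le.2 hi)⟩

/-- Apply a ring homomorphism to the coefficients of a differential operator. -/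
def mapCoeff {S : Type*} [CommRing S] [Differential S] (f : R →+* S) (A : DiffOp R) : DiffOp S :=
  ⟨⟨fun i => f (A.1.coeff i), by
    obtain ⟨N, hN⟩ := A.1.bounded'
    exact ⟨N, fun i hi => by rw [hN i hi, map_zero]⟩⟩,
    fun i hi => by
      change f (A.1.coeff i) = 0
      rw [A.2 i hi, map_zero]⟩

end DiffOp

/-- `Q` is a monic `n`-th root of `A`. -/
def IsMonicRoot {R : Type*} [CommRing R] [Differential R] (n : ℕ) (A Q : PseudoDiffOp R) : Prop :=
  Q.coeff 1 = 1 ∧ Q.OrderLE 1 ∧ Q ^ n = A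

open Classical in
/-- The monic `n`-th root `A^{1/n}`; the value `0` is used only if there is none. -/
noncomputable def monicRoot {R : Type*} [CommRing R] [Differential R] (n : ℕ)
    (A : PseudoDiffOp R) : PseudoDiffOp R :=
  if h : ∃ Q, IsMonicRoot n A Q then h.choose else 0

/-- The ring `k{u_i : i ∈ ι}` of differential polynomials; the variable `(i, j)` is the `j`-th
derivative of `u_i`. -/
abbrev DiffPoly (k ι : Type*) [CommRing k] : Type _ := MvPolynomial (ι × ℕ) k

/-- The derivation of `k{u_i}` is `k`-linear and maps the variable `(i, j)` to `(i, j + 1)`. -/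
noncomputable instance (k ι : Type*) [CommRing k] : Differential (DiffPoly k ι) where
  deriv := Derivation.restrictScalars ℤ
    (MvPolynomial.mkDerivation k (fun v : ι × ℕ => MvPolynomial.X (v.1, v.2 + 1)))

section GelfandDickey

/-- The formal operator `L_n = ∂^n + u_2 ∂^{n-2} + ⋯ + u_n` in normal form. The variable with index
`i : Fin (n - 1)` is the coefficient of `∂^i`, that is, `u_{n-i}`. -/
noncomputable def formalOp (k : Type*) [CommRing k] (n : ℕ) : DiffOp (DiffPoly k (Fin (n - 1))) :=
  ⟨⟨fun i => if i = n then 1 else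
      if h : 0 ≤ i ∧ i.toNat < n - 1 then
        MvPolynomial.X (⟨i.toNat, h.2⟩, 0)
      else 0,
    n, fun i hi => by rw [if_neg (by omega), dif_neg (by omega)]⟩,
    fun i hi => by
      change (if i = n then _ else _) = _
      rw [if_neg (by omega), dif_neg (by omega)]⟩

/-- The almost commuting operator `P_m = (L_n^{m/n})₊`. -/
noncomputable def formalP (k : Type*) [CommRing k] (n m : ℕ) :
    DiffOp (DiffPoly k (Fin (n - 1))) :=
  DiffOp.posPart (monicRoot n (formalOp k n).1 ^ m)

/-- The differential polynomial `H_{i,m}`: the coefficient of `∂^i` in `[P_m, L_n]`. -/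
noncomputable def formalH (k : Type*) [CommRing k] (n : ℕ) (i : Fin (n - 1)) (m : ℕ) :
    DiffPoly k (Fin (n - 1)) :=
  (formalP k n m * formalOp k n - formalOp k n * formalP k n m).1.coeff i.1

variable {K : Type*} [Field K] [Differential K]

/-- The specialization `E_L : C{U} → K`, which maps `u_j` to the coefficient `v_j` of `L` and
its `l`-th derivative to the `l`-th derivative of `v_j`. -/
noncomputable def specialize (n : ℕ) (L : DiffOp K) :
    DiffPoly (constants K) (Fin (n - 1)) →+* K :=
  MvPolynomial.eval₂Hom (constants K).subtype
    (fun v : Fin (n - 1) × ℕ => iterDeriv v.2 (L.1.coeff (v.1 : ℕ)))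

/-- `B_m = E_L(P_m)`. -/
noncomputable def opB (n : ℕ) (L : DiffOp K) (m : ℕ) : DiffOp K :=
  DiffOp.mapCoeff (specialize n L) (formalP (constants K) n m)

/-- `σ_{i,m} = E_L(H_{i,m})`. -/
noncomputable def sigma (n : ℕ) (L : DiffOp K) (i : Fin (n - 1)) (m : ℕ) : K :=
  specialize n L (formalH (constants K) n i m)

/-- The index set of the optimized system at `m`: the `j < m` which are not of the form
`M_k + h n` with `h ≥ 0` and `M_k` in the list of orders found so far. -/
def optIndex (n m : ℕ) (orders : List ℕ) : Finset ℕ :=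
  (Finset.range m).filter (fun j => ∀ q ∈ orders, ¬ (q ≤ j ∧ j ≡ q [MOD n]))

/-- `ξ` is a solution with constant entries of the linear system `b + ∑_j c_j A_j = 0`. -/
def IsConstSolution {r : ℕ} {J : Finset ℕ} (A : Fin r → J → K) (b : Fin r → K)
    (ξ : J → constants K) : Prop :=
  ∀ i, b i + ∑ j, (ξ j : K) * A i j = 0

/-- `ξ` is a constant solution of the optimized system `GD*_{n,m}(L)`:
`σ_m + ∑_{j ∈ J} c_j σ_j = 0`. -/
def IsGDSolution (n : ℕ) (L : DiffOp K) (m : ℕ) (J : Finset ℕ) (ξ : J → constants K) : Prop :=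
  IsConstSolution (fun i j => sigma n L i j.1) (fun i => sigma n L i m) ξ

/-- The operator `B_m + ∑_{j ∈ J} ξ_j B_j`. -/
noncomputable def combB (n : ℕ) (L : DiffOp K) (m : ℕ) (J : Finset ℕ) (ξ : J → constants K) :
    DiffOp K :=
  opB n L m + ∑ j, ξ j • opB n L j.1

end GelfandDickey

section Centralizer
variable {K : Type*} [Field K] [Differential K]

/-- `C[L]`. -/
noncomputable abbrev polyRing (L : DiffOp K) : Subalgebra (constants K) (DiffOp K) :=
  Algebra.adjoin (constants K) {L}

/-- The centralizer `Z(L)` as a `C[L]`-submodule of `K[∂]`. -/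
noncomputable def centralizerOp (L : DiffOp K) : Submodule (polyRing L) (DiffOp K) where
  carrier := {A | L * A = A * L}
  add_mem' := fun {A B} (hA : L * A = A * L) (hB : L * B = B * L) =>
    show L * (A + B) = (A + B) * L by rw [mul_add, add_mul, hA, hB]
  zero_mem' := show L * 0 = 0 * L by rw [mul_zero, zero_mul]
  smul_mem' := fun c A (hA : L * A = A * L) => by
    have hc : L * c.1 = c.1 * L := by
      have h : Algebra.adjoin (constants K) {L} ≤ Subalgebra.centralizer (constants K) {L} :=
        Algebra.adjoin_le (by
          intro x hx
          rw [Set.mem_singleton_iff] at hx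
          subst hx
          exact (Subalgebra.mem_centralizer_iff _).2 (by simp))
      exact (Subalgebra.mem_centralizer_iff _).1 (h c.2) L rfl
    change L * (c.1 * A) = (c.1 * A) * L
    rw [← mul_assoc, hc, mul_assoc, hA, mul_assoc]

/-- `Z_m(L)`: the operators of order at most `m` in `Z(L)`, a `C`-vector space. -/
noncomputable def centralizerLE (L : DiffOp K) (m : ℤ) : Submodule (constants K) (DiffOp K) where
  carrier := {A | A ∈ centralizerOp L ∧ A.1.OrderLE m}
  add_mem' := fun {A B} hA hB => ⟨add_mem hA.1 hB.1, PseudoDiffOp.OrderLE.add hA.2 hB.2⟩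
  zero_mem' := ⟨zero_mem _, fun _ _ => rfl⟩
  smul_mem' := fun c A hA => ⟨by
      have h : L * A = A * L := hA.1
      change L * (c • A) = (c • A) * L
      rw [mul_smul_comm, smul_mul_assoc, h],
    fun i hi => by
      change (c • A.1).coeff i = 0
      rw [PseudoDiffOp.smul_coeff, hA.2 i hi, mul_zero]⟩

/-- `L` has order `n` and is in normal form. -/
def IsNormalForm (n : ℕ) (L : DiffOp K) : Prop :=
  L.1.coeff n = 1 ∧ L.1.coeff (n - 1) = 0 ∧ L.1.OrderLE n

/-- `M` is the level of `L`: the smallest `M` such that `Z_M(L)` is not contained in `C[L]`. -/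
def IsLevel (L : DiffOp K) (M : ℕ) : Prop :=
  IsLeast {m : ℕ | ¬ ∀ A ∈ centralizerLE L m, A ∈ polyRing L} M

/-- The list `G` is a basis of the `C[L]`-module `N`. -/
def IsBasisOf (L : DiffOp K) (G : List (DiffOp K)) (N : Submodule (polyRing L) (DiffOp K)) : Prop :=
  LinearIndependent (polyRing L) (fun i : Fin G.length => G.get i) ∧
    Submodule.span (polyRing L) (Set.range fun i : Fin G.length => G.get i) = N

/-- `G` is order minimal in `Z(L)` (for `L` of order `n`). -/
def IsOrderMinimal (n : ℕ) (L : DiffOp K) (G : DiffOp K) : Prop :=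
  G ∈ centralizerOp L ∧ ∃ m : ℕ, G.1.HasOrder m ∧
    ∀ Q ∈ centralizerOp L, ∀ q : ℕ, Q.1.HasOrder q → q ≡ m [MOD n] → m ≤ q

/-- `N` is a maximal `C[L]`-submodule of rank `ρ` of `Z(L)`: it has a basis
`G_0 = 1, G_1, …, G_{d-1}`, `d = n / ρ`, of operators which are order minimal in `Z(L)` and such
that `ord G_k` is congruent to `k ρ` modulo `n`. -/
def IsMaximalOfRank (n ρ : ℕ) (L : DiffOp K) (N : Submodule (polyRing L) (DiffOp K)) : Prop :=
  ∃ G : List (DiffOp K), G.length = n / ρ ∧ G.head? = some 1 ∧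
    (∀ k : Fin G.length, IsOrderMinimal n L (G.get k) ∧
      ∃ m : ℕ, (G.get k).1.HasOrder m ∧ m ≡ k * ρ [MOD n]) ∧
    IsBasisOf L G N

/-- The list `G = [1, G_1, …, G_{d-1}]` is the filtered basis of `Z(L)`: a basis of `Z(L)` as a
`C[L]`-module, with strictly increasing orders `0 = M_0 < M_1 < ⋯`, such that for `i ≥ 1`
`Z_{M_i}(L) = Z_{M_i - 1}(L) ⊕ C G_i` and `G_i = B_{M_i} + ∑_j c_j B_j` for the unique constant
solution `c` of the system `GD*_{n,M_i}(L)`. -/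
def IsFilteredBasis (n : ℕ) (L : DiffOp K) (G : List (DiffOp K)) : Prop :=
  IsBasisOf L G (centralizerOp L) ∧ G.head? = some 1 ∧
  ∃ M : Fin G.length → ℕ, StrictMono M ∧ (∀ i, (G.get i).1.HasOrder (M i)) ∧
    ∀ i : Fin G.length, i.1 ≠ 0 →
      (Disjoint (centralizerLE L ((M i : ℤ) - 1)) (Submodule.span (constants K) {G.get i}) ∧
        centralizerLE L ((M i : ℤ) - 1) ⊔ Submodule.span (constants K) {G.get i} =
          centralizerLE L (M i)) ∧
      ∃ c : optIndex n (M i) (List.ofFn M) → constants K,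
        (∀ ξ, IsGDSolution n L (M i) (optIndex n (M i) (List.ofFn M)) ξ ↔ ξ = c) ∧
        G.get i = combB n L (M i) (optIndex n (M i) (List.ofFn M)) c

end Centralizer

section Algorithm
variable {K : Type*} [Field K] [Differential K]

/-- A solver for the constant solutions of linear systems over `K` with unknowns indexed by a
finite set of natural numbers: it returns some constant solution if there is one, and reports
failure otherwise. -/
structure ConstSolver (K : Type*) [Field K] [Differential K] where
  solve : (r : ℕ) → (J : Finset ℕ) → (Fin r → J → K) → (Fin r → K) → Option (J → constants K)
  sound : ∀ r J A b ξ, solve r J A b = some ξ → IsConstSolution A b ξ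
  complete : ∀ r J A b, solve r J A b = none → ¬ ∃ ξ, IsConstSolution A b ξ

open Classical in
/-- One pass of the loop of the algorithm at `m`. The state is the list of the operators found so
far, together with their orders. -/
noncomputable def filteredStep (S : ConstSolver K) (n : ℕ) (L : DiffOp K)
    (st : List (ℕ × DiffOp K)) (m : ℕ) : List (ℕ × DiffOp K) :=
  if ∃ p ∈ st, m ≡ p.1 [MOD n] then st else
    match S.solve (n - 1) (optIndex n m (st.map Prod.fst))
        (fun i j => sigma n L i j.1) (fun i => sigma n L i m) with
    | none => st
    | some ξ => st ++ [(m, combB n L m (optIndex n m (st.map Prod.fst)) ξ)]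

/-- The algorithm `Filtered_basis`: run through `m = M, …, (n / (n, M) - 1) M`, starting from the
operator `1` of order `0`, and return the list of operators found. -/
noncomputable def filteredBasis (S : ConstSolver K) (n : ℕ) (L : DiffOp K) (M : ℕ) :
    List (DiffOp K) :=
  ((List.range' M ((n / n.gcd M - 1) * M + 1 - M)).foldl (filteredStep S n L)
    [(0, 1)]).map Prod.snd

end Algorithm

/-! Everything is read off from the set W of orders of nonzero elements of Z(L), a submonoid of ℕ
containing n (`orderSet`). In characteristic zero the leading coefficient of an element of Z(L) is a
constant (`deriv_coeff_eq_zero`), so each Z_m/Z_{m-1} has dimension at most one over C, and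
membership in a submodule can be shown by descent on the order (`mem_of_forall_hasOrder`). Nonzero
elements of C[L] have order divisible by n. Hence operators of pairwise incongruent orders are
independent over C[L], and one operator for each minimum of a residue class of W modulo n
(`classMin`) gives a basis of Z(L).

With L = Q^n and B_m = (Q^m)₊, the operator B_m commutes with L up to order n - 2, so the equations
at m say precisely that the combination of the B_j lies in Z(L) (`isGDSolution_iff`). Every monic
element of Z(L) of order m is B_m plus a constant combination of lower B_j (`sub_opB_mem_spanB`).
Unknowns c_j with j in W are redundant. With the others only, the system is solvable if m is in W
(`exists_isGDSolution`), and its solution is unique, because two solutions would differ by an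
element of Z(L) whose order is outside W (`isGDSolution_unique`). The index set J* is exactly this
one as soon as the known orders below m are the class minima below m (`optIndex_eq_nonOrders`).

So before the pass at m the algorithm holds the reduced operators of all class minima below m
(`IsState.step`); the choice made by the solver is immaterial. The multiples jM with j < d lie in W
and meet every class of multiples of ρ, so the minima of these classes are at most (d - 1)M
(`IsLevel.exists_classMin_le`). For ρ = 1 these are all classes, and the output is a filtered basis;
conversely, uniqueness of the solutions forces any filtered basis to consist of the same reduced
operators (`IsFilteredBasis.exists_isReducedFamily`). For general ρ the output generates everything
in Z(L) of order at most (d - 1)M, which includes the bases of the maximal submodules. -/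

namespace PseudoDiffOp
variable {R : Type*} [CommRing R] [Differential R]

/-! ### Orders and leading coefficients of pseudo-differential operators -/

theorem OrderLE.neg {A : PseudoDiffOp R} {m : ℤ} (h : A.OrderLE m) : (-A).OrderLE m :=
  fun i hi => by rw [neg_coeff, h i hi, neg_zero]

theorem OrderLE.sub {A B : PseudoDiffOp R} {m : ℤ} (h : A.OrderLE m) (h' : B.OrderLE m) :
    (A - B).OrderLE m := by
  rw [sub_eq_add_neg]; exact h.add h'.neg

theorem orderLE_zero (m : ℤ) : (0 : PseudoDiffOp R).OrderLE m := fun _ _ => rfl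

theorem orderLE_one : (1 : PseudoDiffOp R).OrderLE 0 := fun _ hi => if_neg (ne_of_gt hi)

theorem OrderLE.pred {A : PseudoDiffOp R} {m : ℤ} (h : A.OrderLE m) (h' : A.coeff m = 0) :
    A.OrderLE (m - 1) := fun i hi => by
  rcases eq_or_ne i m with rfl | hne
  · exact h'
  · exact h i (by omega)

theorem coeff_mul_top {A B : PseudoDiffOp R} {m m' : ℤ} (hA : A.OrderLE m) (hB : B.OrderLE m') :
    (A * B).coeff (m + m') = A.coeff m * B.coeff m' := by
  rw [mul_coeff, mulCoeff_eq A B _ hA hB {m} {m'} (by simp) (by simp)]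
  simp [term, iterDeriv_zero]

/-- One step below the top, only the product of the two leading terms contributes a derivative, with
binomial coefficient m. This coefficient detects whether leading coefficients are constant. -/
theorem coeff_mul_next {A B : PseudoDiffOp R} {m m' : ℤ} (hA : A.OrderLE m) (hB : B.OrderLE m') :
    (A * B).coeff (m + m' - 1) = A.coeff m * B.coeff (m' - 1) + A.coeff (m - 1) * B.coeff m' +
      (m : R) * (A.coeff m * Differential.deriv (B.coeff m')) := by
  rw [mul_coeff, mulCoeff_eq A B _ hA hB {m - 1, m} {m' - 1, m'}
    (fun x hx => by have := Finset.mem_Icc.1 hx; simp; omega)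
    (fun x hx => by have := Finset.mem_Icc.1 hx; simp; omega)]
  rw [Finset.sum_pair (by omega), Finset.sum_pair (by omega), Finset.sum_pair (by omega)]
  have h1 : (m - 1 + m' - (m + m' - 1)).toNat = 0 := by omega
  have h2 : (m + (m' - 1) - (m + m' - 1)).toNat = 0 := by omega
  have h3 : (m + m' - (m + m' - 1)).toNat = 1 := by omega
  rw [term, if_neg (by omega), term, if_pos (by omega), term, if_pos (by omega), term,
    if_pos (by omega), h1, h2, h3]
  simp only [Ring.choose_zero_right, Ring.choose_one_right, iterDeriv_zero, Int.cast_one, one_mul,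
    iterDeriv_succ 0]
  ring

theorem OrderLE.pow {A : PseudoDiffOp R} {m : ℤ} (hA : A.OrderLE m) (k : ℕ) :
    (A ^ k).OrderLE (k * m) := by
  induction k with
  | zero => simpa using orderLE_one
  | succ k ih =>
    rw [pow_succ]
    exact (ih.mul hA).mono (by push_cast; linarith)

theorem coeff_pow_top {A : PseudoDiffOp R} {m : ℤ} (hA : A.OrderLE m) (k : ℕ) :
    (A ^ k).coeff (k * m) = A.coeff m ^ k := by
  induction k with
  | zero => simp [one_coeff]
  | succ k ih =>
    rw [pow_succ, show ((k + 1 : ℕ) : ℤ) * m = k * m + m by push_cast; ring,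
      coeff_mul_top (hA.pow k) hA, ih, pow_succ]

theorem HasOrder.ne_zero {A : PseudoDiffOp R} {m : ℤ} (h : A.HasOrder m) : A ≠ 0 := by
  rintro rfl; exact h.1 rfl

theorem HasOrder.le {A : PseudoDiffOp R} {m m' : ℤ} (h : A.HasOrder m) (h' : A.OrderLE m') :
    m ≤ m' := by
  by_contra hc
  exact h.1 (h' m (not_le.1 hc))

theorem HasOrder.unique {A : PseudoDiffOp R} {m m' : ℤ} (h : A.HasOrder m) (h' : A.HasOrder m') :
    m = m' := le_antisymm (h.le h'.2) (h'.le h.2)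

theorem HasOrder.mul [IsDomain R] {A B : PseudoDiffOp R} {m m' : ℤ} (h : A.HasOrder m)
    (h' : B.HasOrder m') : (A * B).HasOrder (m + m') :=
  ⟨by rw [coeff_mul_top h.2 h'.2]; exact mul_ne_zero h.1 h'.1, h.2.mul h'.2⟩

/-! ### Existence of monic roots by successive approximation -/

/-- The operator `a ∂^k`. -/
def monomial (k : ℤ) (a : R) : PseudoDiffOp R :=
  ⟨fun i => if i = k then a else 0, k, fun _ hi => if_neg (ne_of_gt hi)⟩

theorem monomial_coeff (k i : ℤ) (a : R) : (monomial k a).coeff i = if i = k then a else 0 := rfl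

theorem orderLE_monomial (k : ℤ) (a : R) : (monomial k a).OrderLE k :=
  fun _ hi => if_neg (ne_of_gt hi)

theorem OrderLE.pow_add_sub_pow {Q E : PseudoDiffOp R} {k : ℤ} (hQ : Q.OrderLE 1)
    (hE : E.OrderLE k) (hk : k ≤ 1) (n : ℕ) : ((Q + E) ^ n - Q ^ n).OrderLE (n - 1 + k) := by
  induction n with
  | zero => simpa using orderLE_zero _
  | succ n ih =>
    have h : (Q + E) ^ (n + 1) - Q ^ (n + 1) = ((Q + E) ^ n - Q ^ n) * (Q + E) + Q ^ n * E := by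
      rw [pow_succ, pow_succ]; noncomm_ring
    rw [h]
    exact ((ih.mul (hQ.add (hE.mono hk))).mono (by push_cast; linarith)).add
      (((hQ.pow n).mul hE).mono (by push_cast; linarith))

/-- Expanding the difference by telescoping gives n products, each with one factor E among factors
of leading coefficient 1. So a correction of Q by a ∂^k changes the n-th power, to first order, by n
a ∂^(n-1+k); inverting n then allows an error to be removed. -/
theorem coeff_pow_add_sub_pow {Q E : PseudoDiffOp R} {k : ℤ} (hQ : Q.OrderLE 1)
    (hQ1 : Q.coeff 1 = 1) (hE : E.OrderLE k) (hk : k ≤ 0) (n : ℕ) :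
    ((Q + E) ^ n - Q ^ n).coeff (n - 1 + k) = n * E.coeff k := by
  induction n with
  | zero => simp [zero_coeff]
  | succ n ih =>
    have h : (Q + E) ^ (n + 1) - Q ^ (n + 1) = ((Q + E) ^ n - Q ^ n) * (Q + E) + Q ^ n * E := by
      rw [pow_succ, pow_succ]; noncomm_ring
    have h1 := coeff_mul_top (hQ.pow_add_sub_pow hE (by omega) n) (hQ.add (hE.mono (by omega)))
    have h2 := coeff_mul_top (hQ.pow n) hE
    rw [ih, add_coeff, hQ1, hE 1 (by omega)] at h1
    rw [coeff_pow_top hQ, hQ1] at h2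
    rw [h, add_coeff, show ((n + 1 : ℕ) : ℤ) - 1 + k = n - 1 + k + 1 by push_cast; ring, h1,
      show (n : ℤ) - 1 + k + 1 = n * 1 + k by ring, h2]
    push_cast
    ring

/-- Successive approximations of a monic `n`-th root of `A`, where `u` is the inverse of `n`. -/
noncomputable def rootApprox (A : PseudoDiffOp R) (n : ℕ) (u : R) : ℕ → PseudoDiffOp R
  | 0 => monomial 1 1
  | k + 1 => rootApprox A n u k +
      monomial (-k) (u * (A - rootApprox A n u k ^ n).coeff (n - 1 - k))

theorem rootApprox_succ (A : PseudoDiffOp R) (n : ℕ) (u : R) (k : ℕ) :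
    rootApprox A n u (k + 1) = rootApprox A n u k +
      monomial (-k) (u * (A - rootApprox A n u k ^ n).coeff (n - 1 - k)) := rfl

theorem rootApprox_coeff_succ (A : PseudoDiffOp R) (n : ℕ) (u : R) (k : ℕ) (i : ℤ) (hi : i ≠ -k) :
    (rootApprox A n u (k + 1)).coeff i = (rootApprox A n u k).coeff i := by
  rw [rootApprox, add_coeff, monomial_coeff, if_neg hi, add_zero]

theorem rootApprox_coeff_of_le (A : PseudoDiffOp R) (n : ℕ) (u : R) {k k' : ℕ} (h : k ≤ k') (i : ℤ)
    (hi : -k < i) : (rootApprox A n u k').coeff i = (rootApprox A n u k).coeff i := by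
  induction k', h using Nat.le_induction with
  | base => rfl
  | succ m hm ih => rw [rootApprox_coeff_succ _ _ _ _ _ (by omega), ih]

theorem rootApprox_orderLE (A : PseudoDiffOp R) (n : ℕ) (u : R) (k : ℕ) :
    (rootApprox A n u k).OrderLE 1 := fun i hi => by
  rw [rootApprox_coeff_of_le A n u (Nat.zero_le k) i (by push_cast; omega)]
  exact orderLE_monomial _ _ i hi

theorem rootApprox_coeff_one (A : PseudoDiffOp R) (n : ℕ) (u : R) (k : ℕ) :
    (rootApprox A n u k).coeff 1 = 1 := by
  rw [rootApprox_coeff_of_le A n u (Nat.zero_le k) 1 (by norm_num)]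
  simp [rootApprox, monomial_coeff]

/-- The correction at stage k is chosen so that n times its coefficient equals the current error at
∂^(n-1-k); the order of the error therefore drops at each stage. -/
theorem sub_rootApprox_pow_orderLE {A : PseudoDiffOp R} {n : ℕ} {u : R} (hu : n * u = 1)
    (hA : A.OrderLE n) (hA1 : A.coeff n = 1) (k : ℕ) :
    (A - rootApprox A n u k ^ n).OrderLE (n - 1 - k) := by
  induction k with
  | zero =>
    have h1 := (orderLE_monomial 1 (1 : R)).pow n
    have h2 := coeff_pow_top (orderLE_monomial 1 (1 : R)) n
    rw [mul_one] at h1 h2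
    rw [rootApprox, Nat.cast_zero, sub_zero]
    apply (hA.sub h1).pred
    rw [sub_coeff, h2, hA1]
    simp [monomial_coeff]
  | succ k ih =>
    have hQ := rootApprox_orderLE A n u k
    have hE := orderLE_monomial (-k) (u * (A - rootApprox A n u k ^ n).coeff (n - 1 - k))
    have h1 := hQ.pow_add_sub_pow hE (by omega) n
    have h2 := coeff_pow_add_sub_pow hQ (rootApprox_coeff_one A n u k) hE (by omega) n
    rw [← sub_eq_add_neg, ← rootApprox_succ] at h1 h2
    have h3 : A - rootApprox A n u (k + 1) ^ n = (A - rootApprox A n u k ^ n) -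
        (rootApprox A n u (k + 1) ^ n - rootApprox A n u k ^ n) := by abel
    rw [h3, show (n : ℤ) - 1 - (k + 1 : ℕ) = n - 1 - k - 1 by push_cast; ring]
    apply (ih.sub h1).pred
    rw [sub_coeff, h2, monomial_coeff, if_pos rfl, ← mul_assoc, hu, one_mul, sub_self]

theorem exists_isMonicRoot {A : PseudoDiffOp R} {n : ℕ} {u : R} (hu : n * u = 1)
    (hA : A.OrderLE n) (hA1 : A.coeff n = 1) : ∃ Q, IsMonicRoot n A Q := by
  -- Stage k changes only the coefficient of ∂^(-k), so that of ∂^i is final from approximation 1 -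
  -- i on.
  let Q : PseudoDiffOp R := ⟨fun i => (rootApprox A n u (1 - i).toNat).coeff i, 1,
    fun i hi => rootApprox_orderLE A n u _ i hi⟩
  have hQ : ∀ k : ℕ, (Q - rootApprox A n u k).OrderLE (-k) := fun k i hi => by
    rw [sub_coeff]
    exact sub_eq_zero.2 (rootApprox_coeff_of_le A n u (k := (1 - i).toNat) (by omega) i
      (by omega)).symm
  refine ⟨Q, rootApprox_coeff_one A n u (1 - 1 : ℤ).toNat, fun i hi => rootApprox_orderLE A n u _ i hi, ?_⟩
  rw [eq_comm, ← sub_eq_zero]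
  ext i
  -- With k = n - i, both A minus the k-th approximate power and that power minus Q^n have order
  -- below i.
  have h1 := (rootApprox_orderLE A n u (n - i).toNat).pow_add_sub_pow (hQ (n - i).toNat)
    (by omega) n
  rw [add_sub_cancel] at h1
  have h2 := sub_rootApprox_pow_orderLE hu hA hA1 (n - i).toNat
  have h3 : A - Q ^ n = (A - rootApprox A n u (n - i).toNat ^ n) -
      (Q ^ n - rootApprox A n u (n - i).toNat ^ n) := by abel
  rw [h3]
  exact (h2.sub h1) i (by omega)

/-! ### Functoriality in the coefficient ring -/

theorem map_iterDeriv {S : Type*} [CommRing S] [Differential S] (f : R →+* S)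
    (hf : ∀ a, f (Differential.deriv a) = Differential.deriv (f a)) (l : ℕ) (a : R) :
    f (iterDeriv l a) = iterDeriv l (f a) := by
  induction l with
  | zero => rfl
  | succ l ih => rw [iterDeriv_succ, iterDeriv_succ, hf, ih]

/-- The map on operators induced by a homomorphism of differential rings. -/
noncomputable def map {S : Type*} [CommRing S] [Differential S] (f : R →+* S)
    (hf : ∀ a, f (Differential.deriv a) = Differential.deriv (f a)) :
    PseudoDiffOp R →+* PseudoDiffOp S where
  toFun A := ⟨fun i => f (A.coeff i), by
    obtain ⟨N, hN⟩ := A.bounded'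
    exact ⟨N, fun i hi => by rw [hN i hi, map_zero]⟩⟩
  map_zero' := by ext i; exact map_zero f
  map_one' := by
    ext i
    change f (if i = 0 then 1 else 0) = if i = 0 then 1 else 0
    split_ifs <;> simp
  map_add' A B := by ext i; exact map_add f _ _
  map_mul' A B := by
    ext k
    obtain ⟨N, _, hA, hB, -⟩ := exists_common_bound A B 0
    rw [mulCoeff_eq_of_le _ _ k N (fun i hi => (congrArg f (hA i hi)).trans (map_zero f))
      (fun i hi => (congrArg f (hB i hi)).trans (map_zero f))]
    change f ((A * B).coeff k) = _
    rw [mulCoeff_eq_of_le A B k N hA hB]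
    simp only [map_sum, term]
    refine Finset.sum_congr rfl fun i _ => Finset.sum_congr rfl fun j _ => ?_
    split_ifs
    · rw [map_mul, map_mul, map_intCast, map_iterDeriv f hf]
    · exact map_zero f

theorem map_coeff {S : Type*} [CommRing S] [Differential S] (f : R →+* S)
    (hf : ∀ a, f (Differential.deriv a) = Differential.deriv (f a)) (A : PseudoDiffOp R) (i : ℤ) :
    (map f hf A).coeff i = f (A.coeff i) := rfl

end PseudoDiffOp

/-! ### Coefficients and positive parts of differential operators -/

namespace DiffOp
variable {R : Type*} [CommRing R] [Differential R]

theorem posPart_coeff (A : PseudoDiffOp R) (i : ℤ) :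
    (posPart A).1.coeff i = if 0 ≤ i then A.coeff i else 0 := rfl

theorem ext_coeff {A B : DiffOp R} (h : ∀ i, A.1.coeff i = B.1.coeff i) : A = B :=
  Subtype.ext (PseudoDiffOp.ext (funext h))

theorem add_coeff (A B : DiffOp R) (i : ℤ) : (A + B).1.coeff i = A.1.coeff i + B.1.coeff i := rfl

theorem sub_coeff (A B : DiffOp R) (i : ℤ) : (A - B).1.coeff i = A.1.coeff i - B.1.coeff i :=
  PseudoDiffOp.sub_coeff A.1 B.1 i

theorem smul_coeff (c : constants R) (A : DiffOp R) (i : ℤ) :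
    (c • A).1.coeff i = c * A.1.coeff i := PseudoDiffOp.smul_coeff c A.1 i

/-- The coefficient of `∂^i`, as a linear map over the constants. -/
noncomputable def coeffₗ (i : ℤ) : DiffOp R →ₗ[constants R] R where
  toFun A := A.1.coeff i
  map_add' _ _ := rfl
  map_smul' c A := smul_coeff c A i

theorem sum_coeff {ι : Type*} (s : Finset ι) (f : ι → DiffOp R) (i : ℤ) :
    (∑ j ∈ s, f j).1.coeff i = ∑ j ∈ s, (f j).1.coeff i := map_sum (coeffₗ i) f s

theorem posPart_add (A B : PseudoDiffOp R) : posPart (A + B) = posPart A + posPart B := by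
  refine ext_coeff fun i => ?_
  rw [add_coeff, posPart_coeff, posPart_coeff, posPart_coeff, PseudoDiffOp.add_coeff]
  split_ifs <;> simp

theorem posPart_smul (c : constants R) (A : PseudoDiffOp R) : posPart (c • A) = c • posPart A := by
  refine ext_coeff fun i => ?_
  rw [smul_coeff, posPart_coeff, posPart_coeff, PseudoDiffOp.smul_coeff]
  split_ifs <;> simp

theorem posPart_coe (A : DiffOp R) : posPart A.1 = A := by
  refine ext_coeff fun i => ?_
  rw [posPart_coeff]
  split_ifs with h
  · rfl
  · exact (A.2 i (not_le.1 h)).symm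

theorem posPart_eq_zero {A : PseudoDiffOp R} (h : A.OrderLE (-1)) : posPart A = 0 := by
  refine ext_coeff fun i => ?_
  rw [posPart_coeff]
  split_ifs with hi
  · exact h i (by omega)
  · rfl

theorem sub_posPart_orderLE (A : PseudoDiffOp R) : (A - (posPart A).1).OrderLE (-1) := by
  intro i hi
  rw [PseudoDiffOp.sub_coeff, posPart_coeff, if_pos (by omega), sub_self]

theorem OrderLE.posPart {A : PseudoDiffOp R} {m : ℤ} (h : A.OrderLE m) :
    (posPart A).1.OrderLE m := fun i hi => by
  rw [posPart_coeff, h i hi, ite_self]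

end DiffOp

/-! ### Specialization of the formal operators to L -/

section GelfandDickey
open DiffOp
variable {K : Type*} [Field K] [Differential K]

theorem inv_mem_constants {c : K} (hc : c ∈ constants K) : c⁻¹ ∈ constants K := by
  have h : Differential.deriv c = 0 := hc
  change Differential.deriv c⁻¹ = 0
  rw [Derivation.leibniz_inv, h, smul_zero]

theorem specialize_deriv (n : ℕ) (L : DiffOp K) (p : DiffPoly (constants K) (Fin (n - 1))) :
    specialize n L (Differential.deriv p) = Differential.deriv (specialize n L p) := by
  have hd : ∀ p : DiffPoly (constants K) (Fin (n - 1)), Differential.deriv p =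
      MvPolynomial.mkDerivation (constants K)
        (fun v : Fin (n - 1) × ℕ => MvPolynomial.X (v.1, v.2 + 1)) p := fun _ => rfl
  induction p using MvPolynomial.induction_on with
  | C c =>
    have h : specialize n L (MvPolynomial.C c) = c := by simp [specialize]
    rw [hd, MvPolynomial.derivation_C, map_zero, h, c.2]
  | add p q hp hq => rw [map_add, map_add, hp, hq, map_add, map_add]
  | mul_X p v hp =>
    have hX : ∀ v : Fin (n - 1) × ℕ, specialize n L (MvPolynomial.X v) =
        iterDeriv v.2 (L.1.coeff (v.1 : ℕ)) := fun v => by simp [specialize]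
    rw [Derivation.leibniz, map_add, smul_eq_mul, smul_eq_mul, map_mul, map_mul, hp, hd,
      MvPolynomial.mkDerivation_X, hX, hX, iterDeriv_succ, map_mul, Derivation.leibniz, hX]
    rfl

theorem map_specialize_formalOp {n : ℕ} {L : DiffOp K} (hL : IsNormalForm n L) :
    PseudoDiffOp.map (specialize n L) (specialize_deriv n L) (formalOp (constants K) n).1 = L.1 := by
  ext i
  rw [PseudoDiffOp.map_coeff]
  change specialize n L (if i = n then 1 else if h : 0 ≤ i ∧ i.toNat < n - 1 then
    MvPolynomial.X (⟨i.toNat, h.2⟩, 0) else 0) = _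
  split_ifs with h1 h2
  · rw [map_one, h1, hL.1]
  · simp only [specialize, MvPolynomial.coe_eval₂Hom, MvPolynomial.eval₂_X, iterDeriv_zero]
    rw [Int.toNat_of_nonneg h2.1]
  · rw [map_zero]
    rcases lt_trichotomy i (n - 1) with h | h | h
    · exact (L.2 i (by omega)).symm
    · rw [h, hL.2.1]
    · exact (hL.2.2 i (by omega)).symm

theorem formalOp_orderLE (k : Type*) [CommRing k] (n : ℕ) : (formalOp k n).1.OrderLE n :=
  fun i hi => by
    change (if i = n then _ else _) = _
    rw [if_neg (by omega), dif_neg (by omega)]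

/-- Specialization is a homomorphism of differential rings, so it carries the formal root to a monic
root Q of L, and positive parts are taken coefficientwise. From here on only Q^n = L and B_m =
(Q^m)₊ are used; uniqueness of the root is never needed. -/
theorem exists_isMonicRoot_opB [CharZero K] {n : ℕ} (hn : 0 < n) {L : DiffOp K}
    (hL : IsNormalForm n L) :
    ∃ Q, IsMonicRoot n L.1 Q ∧ ∀ m, opB n L m = posPart (Q ^ m) := by
  have hn0 : (n : K) ≠ 0 := Nat.cast_ne_zero.2 hn.ne'
  let u : constants K := ⟨(n : K)⁻¹, inv_mem_constants (natCast_mem _ n)⟩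
  have hu : ((n : ℕ) : DiffPoly (constants K) (Fin (n - 1))) * MvPolynomial.C u = 1 := by
    have : (n : constants K) * u = 1 := Subtype.ext (by simp [u, hn0])
    rw [← map_natCast MvPolynomial.C, ← map_mul, this, map_one]
  have hex := PseudoDiffOp.exists_isMonicRoot hu (formalOp_orderLE (constants K) n) (if_pos rfl)
  have hroot : IsMonicRoot n (formalOp (constants K) n).1
      (monicRoot n (formalOp (constants K) n).1) := by
    rw [monicRoot, dif_pos hex]; exact hex.choose_spec
  refine ⟨PseudoDiffOp.map (specialize n L) (specialize_deriv n L)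
    (monicRoot n (formalOp (constants K) n).1), ⟨?_, ?_, ?_⟩, fun m => ?_⟩
  · rw [PseudoDiffOp.map_coeff, hroot.1, map_one]
  · intro i hi
    rw [PseudoDiffOp.map_coeff, hroot.2.1 i hi, map_zero]
  · rw [← map_pow, hroot.2.2, map_specialize_formalOp hL]
  · refine ext_coeff fun i => ?_
    rw [posPart_coeff, ← map_pow, PseudoDiffOp.map_coeff]
    change specialize n L (if 0 ≤ i then _ else 0) = _
    split_ifs
    · rfl
    · exact map_zero _

theorem sigma_eq {n : ℕ} {L : DiffOp K} (hL : IsNormalForm n L) (i : Fin (n - 1)) (m : ℕ) :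
    sigma n L i m = (opB n L m * L - L * opB n L m).1.coeff i.1 := by
  have h : (opB n L m * L - L * opB n L m).1 =
      PseudoDiffOp.map (specialize n L) (specialize_deriv n L)
        (formalP (constants K) n m * formalOp (constants K) n -
          formalOp (constants K) n * formalP (constants K) n m).1 := by
    have hB : (opB n L m).1 = PseudoDiffOp.map (specialize n L) (specialize_deriv n L)
      (formalP (constants K) n m).1 := rfl
    change (opB n L m).1 * L.1 - L.1 * (opB n L m).1 = PseudoDiffOp.map _ _
      ((formalP (constants K) n m).1 * (formalOp (constants K) n).1 -
        (formalOp (constants K) n).1 * (formalP (constants K) n m).1)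
    rw [map_sub, map_mul, map_mul, map_specialize_formalOp hL, hB]
  rw [h]
  rfl

end GelfandDickey

/-! ### Orders of sums -/

open DiffOp

/-- The nonzero summand of largest order is the only one that contributes at that order, so nothing
cancels. -/
theorem DiffOp.exists_hasOrder_sum {R : Type*} [CommRing R] [Differential R] {ι : Type*}
    [Fintype ι] (A : ι → DiffOp R) (w : ι → ℤ) (hw : ∀ i, A i ≠ 0 → (A i).1.HasOrder (w i))
    (hinj : ∀ i j, A i ≠ 0 → A j ≠ 0 → w i = w j → i = j) (hne : ∃ i, A i ≠ 0) :
    ∃ i, A i ≠ 0 ∧ (∑ j, A j).1.HasOrder (w i) := by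
  classical
  obtain ⟨i, hi, hmax⟩ := (Finset.univ.filter fun i => A i ≠ 0).exists_max_image w
    (by obtain ⟨i, hi⟩ := hne; exact ⟨i, by simpa using hi⟩)
  simp only [Finset.mem_filter, Finset.mem_univ, true_and] at hi hmax
  refine ⟨i, hi, ?_, fun k hk => ?_⟩
  · rw [sum_coeff, Finset.sum_eq_single i]
    · exact (hw i hi).1
    · intro j _ hj
      by_cases h0 : A j = 0
      · rw [h0]; rfl
      · exact (hw j h0).2 _ (lt_of_le_of_ne (hmax j h0) fun h => hj (hinj j i h0 hi h))
    · simp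
  · rw [sum_coeff]
    refine Finset.sum_eq_zero fun j _ => ?_
    by_cases h0 : A j = 0
    · rw [h0]; rfl
    · exact (hw j h0).2 _ (lt_of_le_of_lt (hmax j h0) hk)

theorem DiffOp.exists_hasOrder {R : Type*} [CommRing R] [Differential R] {A : DiffOp R}
    (hA : A ≠ 0) : ∃ m : ℕ, A.1.HasOrder m := by
  obtain ⟨N, hN⟩ := A.1.bounded'
  have key : ∀ m : ℕ, A.1.OrderLE ((m : ℤ) - 1) → ∃ m : ℕ, A.1.HasOrder m := by
    intro m
    induction m with
    | zero =>
      intro h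
      refine absurd (ext_coeff fun i => ?_) hA
      by_cases hi : i < 0
      · exact A.2 i hi
      · exact h i (by push_cast; omega)
    | succ m ih =>
      intro h
      rw [Nat.cast_add, Nat.cast_one, add_sub_cancel_right] at h
      by_cases h0 : A.1.coeff m = 0
      · exact ih (h.pred h0)
      · exact ⟨m, h0, h⟩
  exact key (N + 1).toNat fun i hi => hN i (by omega)

/-! ### The centralizer and its set of orders -/

section Centralizer
variable {K : Type*} [Field K] [Differential K] {n : ℕ} {L : DiffOp K}

/-- The orders of the nonzero elements of the centralizer. -/
def orderSet (L : DiffOp K) : Set ℕ := {m | ∃ A ∈ centralizerOp L, A.1.HasOrder m}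

open Classical in
/-- The indices below `m` which are not orders of elements of the centralizer. -/
noncomputable def nonOrders (L : DiffOp K) (m : ℕ) : Finset ℕ :=
  (Finset.range m).filter (· ∉ orderSet L)

theorem mem_nonOrders {m j : ℕ} : j ∈ nonOrders L m ↔ j < m ∧ j ∉ orderSet L := by
  simp [nonOrders]

theorem mem_centralizerOp {A : DiffOp K} : A ∈ centralizerOp L ↔ L * A = A * L := Iff.rfl

theorem smul_mem_centralizerOp (c : constants K) {A : DiffOp K} (hA : A ∈ centralizerOp L) :
    c • A ∈ centralizerOp L := by
  rw [mem_centralizerOp] at *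
  rw [mul_smul_comm, smul_mul_assoc, hA]

theorem sub_mem_centralizerOp {A B : DiffOp K} (hA : A ∈ centralizerOp L)
    (hB : B ∈ centralizerOp L) : A - B ∈ centralizerOp L := by
  rw [mem_centralizerOp] at *
  rw [mul_sub, sub_mul, hA, hB]

theorem one_mem_centralizerOp : (1 : DiffOp K) ∈ centralizerOp L := by
  rw [mem_centralizerOp, mul_one, one_mul]

theorem mul_mem_centralizerOp {A B : DiffOp K} (hA : A ∈ centralizerOp L)
    (hB : B ∈ centralizerOp L) : A * B ∈ centralizerOp L := by
  rw [mem_centralizerOp] at *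
  rw [← mul_assoc, hA, mul_assoc, hB, mul_assoc]

theorem pow_mem_centralizerOp {A : DiffOp K} (hA : A ∈ centralizerOp L) (k : ℕ) :
    A ^ k ∈ centralizerOp L := by
  induction k with
  | zero => exact one_mem_centralizerOp
  | succ k ih => rw [pow_succ]; exact mul_mem_centralizerOp ih hA

theorem one_hasOrder : (1 : DiffOp K).1.HasOrder 0 :=
  ⟨by change (if (0 : ℤ) = 0 then (1 : K) else 0) ≠ 0; simp, PseudoDiffOp.orderLE_one⟩

theorem pow_hasOrder {A : DiffOp K} {m : ℕ} (hA : A.1.HasOrder m) (k : ℕ) :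
    (A ^ k).1.HasOrder (k * m : ℕ) := by
  rw [Nat.cast_mul]
  refine ⟨?_, PseudoDiffOp.OrderLE.pow hA.2 k⟩
  have := PseudoDiffOp.coeff_pow_top hA.2 k
  change ((A.1) ^ k).coeff _ ≠ 0
  rw [this]
  exact pow_ne_zero _ hA.1

theorem zero_mem_orderSet : 0 ∈ orderSet L := ⟨1, one_mem_centralizerOp, one_hasOrder⟩

theorem add_mem_orderSet {a b : ℕ} (ha : a ∈ orderSet L) (hb : b ∈ orderSet L) :
    a + b ∈ orderSet L := by
  obtain ⟨A, hA, hA'⟩ := ha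
  obtain ⟨B, hB, hB'⟩ := hb
  exact ⟨A * B, mul_mem_centralizerOp hA hB, by rw [Nat.cast_add]; exact hA'.mul hB'⟩

theorem mul_mem_orderSet {a : ℕ} (k : ℕ) (ha : a ∈ orderSet L) : k * a ∈ orderSet L := by
  induction k with
  | zero => rw [zero_mul]; exact zero_mem_orderSet
  | succ k ih => rw [Nat.succ_mul]; exact add_mem_orderSet ih ha

theorem IsNormalForm.hasOrder (hL : IsNormalForm n L) : L.1.HasOrder n :=
  ⟨by rw [hL.1]; exact one_ne_zero, hL.2.2⟩

theorem IsNormalForm.mem_orderSet (hL : IsNormalForm n L) : n ∈ orderSet L :=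
  ⟨L, rfl, hL.hasOrder⟩

theorem mem_orderSet_of_le {a b : ℕ} (hL : IsNormalForm n L) (ha : a ∈ orderSet L) (hab : a ≤ b)
    (h : a ≡ b [MOD n]) : b ∈ orderSet L := by
  obtain ⟨k, hk⟩ := (Nat.modEq_iff_dvd' hab).1 h
  have := add_mem_orderSet ha (mul_mem_orderSet k hL.mem_orderSet)
  rwa [mul_comm, ← hk, Nat.add_sub_cancel' hab] at this

/-- Compare the coefficients of ∂^(n+m-1) in LA and AL: as L is monic with zero coefficient at
∂^(n-1), all that remains is n times the derivative of the top coefficient. Pseudo-differential A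
are allowed because the powers of Q are not differential operators. -/
theorem deriv_coeff_eq_zero [CharZero K] (hn : 0 < n) (hL : IsNormalForm n L)
    {A : PseudoDiffOp K} (hA : L.1 * A = A * L.1) {m : ℤ} (hm : A.OrderLE m) :
    A.coeff m ∈ constants K := by
  have h1 := PseudoDiffOp.coeff_mul_next hL.2.2 hm
  have h2 := PseudoDiffOp.coeff_mul_next hm hL.2.2
  rw [hA, add_comm (n : ℤ) m, h2, hL.1, hL.2.1] at h1
  simp only [mul_one, one_mul, zero_mul, mul_zero, zero_add, add_zero,
    Int.cast_natCast] at h1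
  have h0 : Differential.deriv (1 : K) = 0 := Derivation.map_one_eq_zero _
  rw [h0, mul_zero, mul_zero, add_zero] at h1
  have h3 : (n : K) * Differential.deriv (A.coeff m) = 0 := by linear_combination -h1
  exact (mul_eq_zero.1 h3).resolve_left (Nat.cast_ne_zero.2 hn.ne')

/-- Both top coefficients are constants, hence so is their quotient: Z_m/Z_{m-1} has dimension at
most one. -/
theorem exists_smul_sub_orderLE [CharZero K] (hn : 0 < n) (hL : IsNormalForm n L) {A X : DiffOp K}
    (hA : A ∈ centralizerOp L) (hX : X ∈ centralizerOp L) {m : ℤ} (hA' : A.1.OrderLE m)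
    (hX' : X.1.HasOrder m) : ∃ c : constants K, (A - c • X).1.OrderLE (m - 1) := by
  have h1 := deriv_coeff_eq_zero hn hL (congrArg Subtype.val hA) hA'
  have h2 := deriv_coeff_eq_zero hn hL (congrArg Subtype.val hX) hX'.2
  refine ⟨⟨_, h1⟩ * ⟨_, inv_mem_constants h2⟩, PseudoDiffOp.OrderLE.pred (fun i hi => ?_) ?_⟩
  · rw [sub_coeff, smul_coeff, hA' i hi, hX'.2 i hi, mul_zero, sub_zero]
  · rw [sub_coeff, smul_coeff, Subring.coe_mul, inv_mul_cancel_right₀ hX'.1, sub_self]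

theorem exists_monic_of_mem_orderSet [CharZero K] (hn : 0 < n) (hL : IsNormalForm n L) {m : ℕ}
    (hm : m ∈ orderSet L) : ∃ A ∈ centralizerOp L, A.1.OrderLE m ∧ A.1.coeff m = 1 := by
  obtain ⟨A, hA, hA'⟩ := hm
  have h := inv_mem_constants (deriv_coeff_eq_zero hn hL (congrArg Subtype.val hA) hA'.2)
  refine ⟨(⟨_, h⟩ : constants K) • A, smul_mem_centralizerOp _ hA, fun i hi => ?_, ?_⟩
  · rw [smul_coeff, hA'.2 i hi, mul_zero]
  · rw [smul_coeff]; exact inv_mul_cancel₀ hA'.1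

/-- If every order of an element of `N'` below `b` is attained in `N ∩ N'`, then `N` contains all
elements of `N'` of order below `b`. -/
theorem mem_of_forall_hasOrder [CharZero K] (hn : 0 < n) (hL : IsNormalForm n L)
    (N N' : Submodule (constants K) (DiffOp K)) (hN' : ∀ A ∈ N', A ∈ centralizerOp L) (b : ℕ)
    (h : ∀ w : ℕ, w < b → (∃ A ∈ N', A.1.HasOrder w) → ∃ X ∈ N, X ∈ N' ∧ X.1.HasOrder w)
    {A : DiffOp K} (hA : A ∈ N') (hb : A.1.OrderLE ((b : ℤ) - 1)) : A ∈ N := by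
  induction b generalizing A with
  | zero =>
    by_cases h0 : A = 0
    · rw [h0]; exact zero_mem _
    · obtain ⟨m, hm⟩ := exists_hasOrder h0
      have := hm.le hb
      push_cast at this
      omega
  | succ b ih =>
    rw [Nat.cast_add, Nat.cast_one, add_sub_cancel_right] at hb
    have ih' := fun {A : DiffOp K} => ih (A := A) fun w hw => h w (by omega)
    by_cases h0 : A.1.coeff b = 0
    · exact ih' hA (hb.pred h0)
    · obtain ⟨X, hX, hX', hXo⟩ := h b (by omega) ⟨A, hA, h0, hb⟩
      obtain ⟨c, hc⟩ := exists_smul_sub_orderLE hn hL (hN' A hA) (hN' X hX') hb hXo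
      have := N.add_mem (ih' (sub_mem hA (N'.smul_mem c hX')) hc) (N.smul_mem c hX)
      rwa [sub_add_cancel] at this

end Centralizer

/-! ### Constant combinations of the operators B_j -/

section SpanB
variable {K : Type*} [Field K] [Differential K] {n : ℕ} {L : DiffOp K}

/-- The span of the operators `B_j` with `j ∈ T`. -/
noncomputable def spanB (n : ℕ) (L : DiffOp K) (T : Set ℕ) : Submodule (constants K) (DiffOp K) :=
  Submodule.span (constants K) (opB n L '' T)

theorem opB_mem_spanB {T : Set ℕ} {j : ℕ} (hj : j ∈ T) : opB n L j ∈ spanB n L T :=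
  Submodule.subset_span ⟨j, hj, rfl⟩

theorem spanB_mono {T T' : Set ℕ} (h : T ⊆ T') : spanB n L T ≤ spanB n L T' :=
  Submodule.span_mono (Set.image_mono h)

theorem mem_spanB_finset {J : Finset ℕ} {A : DiffOp K} :
    A ∈ spanB n L J ↔ ∃ ξ : J → constants K, ∑ j, ξ j • opB n L j.1 = A := by
  have h : opB n L '' (J : Set ℕ) = Set.range fun j : J => opB n L j.1 := by
    rw [Set.image_eq_range]; rfl
  rw [spanB, h, Submodule.mem_span_range_iff_exists_fun]

theorem combB_commutator_coeff (J : Finset ℕ) (m : ℕ) (ξ : J → constants K) (i : ℤ) :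
    (combB n L m J ξ * L - L * combB n L m J ξ).1.coeff i =
      (opB n L m * L - L * opB n L m).1.coeff i +
        ∑ j, (ξ j : K) * (opB n L j.1 * L - L * opB n L j.1).1.coeff i := by
  let D := LinearMap.mulRight (constants K) L - LinearMap.mulLeft (constants K) L
  have hD : ∀ A, D A = A * L - L * A := fun _ => rfl
  rw [← hD, combB, map_add, map_sum, add_coeff, sum_coeff]
  refine congrArg _ (Finset.sum_congr rfl fun j _ => ?_)
  rw [LinearMap.map_smul, smul_coeff, hD]

end SpanB

/-! ### The Gelfand–Dickey systems and the centralizer -/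

section GelfandDickey
variable {K : Type*} [Field K] [CharZero K] [Differential K] {n : ℕ} {L : DiffOp K}

theorem opB_orderLE (hn : 0 < n) (hL : IsNormalForm n L) (m : ℕ) : (opB n L m).1.OrderLE m := by
  obtain ⟨Q, hQ, hB⟩ := exists_isMonicRoot_opB hn hL
  have := hQ.2.1.pow m
  rw [mul_one] at this
  rw [hB]
  exact DiffOp.OrderLE.posPart this

theorem opB_coeff_self (hn : 0 < n) (hL : IsNormalForm n L) (m : ℕ) :
    (opB n L m).1.coeff m = 1 := by
  obtain ⟨Q, hQ, hB⟩ := exists_isMonicRoot_opB hn hL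
  have := PseudoDiffOp.coeff_pow_top hQ.2.1 m
  rw [mul_one, hQ.1, one_pow] at this
  rw [hB, posPart_coeff, if_pos (by omega), this]

theorem opB_zero (hn : 0 < n) (hL : IsNormalForm n L) : opB n L 0 = 1 := by
  obtain ⟨Q, hQ, hB⟩ := exists_isMonicRoot_opB hn hL
  rw [hB, pow_zero]
  exact posPart_coe 1

/-- The operator `B_m` almost commutes with `L`. -/
theorem opB_commutator_orderLE (hn : 0 < n) (hL : IsNormalForm n L) (m : ℕ) :
    (opB n L m * L - L * opB n L m).1.OrderLE ((n : ℤ) - 2) := by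
  obtain ⟨Q, hQ, hB⟩ := exists_isMonicRoot_opB hn hL
  have hE := sub_posPart_orderLE (Q ^ m)
  set E := Q ^ m - (posPart (Q ^ m)).1 with hEdef
  -- Since Q^m commutes with L = Q^n, the commutator of B_m with L comes from the negative part E
  -- alone. Its order is at most n - 1, and the coefficient there vanishes because K is commutative.
  have hcomm : Q ^ m * L.1 = L.1 * Q ^ m := by rw [← hQ.2.2, ← pow_add, ← pow_add, add_comm]
  have h : (opB n L m * L - L * opB n L m).1 = L.1 * E - E * L.1 := by
    change (opB n L m).1 * L.1 - L.1 * (opB n L m).1 = _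
    rw [hB, hEdef, mul_sub, sub_mul, hcomm]
    abel
  rw [h, show (n : ℤ) - 2 = n + -1 - 1 by ring]
  apply PseudoDiffOp.OrderLE.pred
  · exact (hL.2.2.mul hE).sub ((hE.mul hL.2.2).mono (by omega))
  · rw [PseudoDiffOp.sub_coeff, PseudoDiffOp.coeff_mul_top hL.2.2 hE, add_comm (n : ℤ),
      PseudoDiffOp.coeff_mul_top hE hL.2.2, mul_comm, sub_self]

/-- The n - 1 equations are the coefficients of ∂^0, …, ∂^(n-2) in the commutator with L; all other
coefficients vanish automatically by almost commutation. -/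
theorem isGDSolution_iff (hn : 0 < n) (hL : IsNormalForm n L) (J : Finset ℕ) (m : ℕ)
    (ξ : J → constants K) : IsGDSolution n L m J ξ ↔ combB n L m J ξ ∈ centralizerOp L := by
  have h1 : IsGDSolution n L m J ξ ↔ ∀ i : Fin (n - 1),
      (combB n L m J ξ * L - L * combB n L m J ξ).1.coeff i.1 = 0 := by
    unfold IsGDSolution IsConstSolution
    simp only [combB_commutator_coeff, sigma_eq hL]
  rw [h1, mem_centralizerOp, eq_comm (a := L * _), ← sub_eq_zero (b := L * _)]
  refine ⟨fun h => ext_coeff fun i => ?_, fun h i => by rw [h]; rfl⟩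
  by_cases hi : i < 0
  · exact Subtype.property (combB n L m J ξ * L - L * combB n L m J ξ) i hi
  · by_cases hi' : i < n - 1
    · have := h ⟨i.toNat, by omega⟩
      rwa [Int.toNat_of_nonneg (by omega)] at this
    · rw [combB_commutator_coeff, opB_commutator_orderLE hn hL m i (by omega), zero_add]
      refine Finset.sum_eq_zero fun j _ => ?_
      rw [opB_commutator_orderLE hn hL j.1 i (by omega), mul_zero]

/-- An operator commuting with L expands in powers of Q with constant coefficients: its top
coefficient c is constant, and A - c Q^m again commutes with L and has smaller order. Taking
positive parts turns Q^j into B_j and kills what remains below order zero. -/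
theorem posPart_mem_spanB (hn : 0 < n) (hL : IsNormalForm n L) (m : ℕ) {A : PseudoDiffOp K}
    (hA : L.1 * A = A * L.1) (hm : A.OrderLE ((m : ℤ) - 1)) :
    posPart A ∈ spanB n L {j | j < m} := by
  obtain ⟨Q, hQ, hB⟩ := exists_isMonicRoot_opB hn hL
  induction m generalizing A with
  | zero => rw [posPart_eq_zero (by simpa using hm)]; exact zero_mem _
  | succ m ih =>
    rw [Nat.cast_add, Nat.cast_one, add_sub_cancel_right] at hm
    have hc := deriv_coeff_eq_zero hn hL hA hm
    have hcomm : L.1 * Q ^ m = Q ^ m * L.1 := by rw [← hQ.2.2, ← pow_add, ← pow_add, add_comm]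
    have hQm := hQ.2.1.pow m
    have hQm' := PseudoDiffOp.coeff_pow_top hQ.2.1 m
    rw [mul_one] at hQm hQm'
    rw [hQ.1, one_pow] at hQm'
    set c : constants K := ⟨_, hc⟩
    have h1 : L.1 * (A - c • Q ^ m) = (A - c • Q ^ m) * L.1 := by
      rw [mul_sub, sub_mul, mul_smul_comm, smul_mul_assoc, hA, hcomm]
    have h2 : (A - c • Q ^ m).OrderLE ((m : ℤ) - 1) := by
      apply PseudoDiffOp.OrderLE.pred
      · exact hm.sub fun i hi => by rw [PseudoDiffOp.smul_coeff, hQm i hi, mul_zero]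
      · rw [PseudoDiffOp.sub_coeff, PseudoDiffOp.smul_coeff, hQm', mul_one, sub_self]
    have h3 : posPart A = posPart (A - c • Q ^ m) + c • opB n L m := by
      rw [hB, ← posPart_smul, ← posPart_add, sub_add_cancel]
    rw [h3]
    exact add_mem (spanB_mono (fun j (hj : j < m) => Nat.lt_succ_of_lt hj) (ih h1 h2))
      (Submodule.smul_mem _ _ (opB_mem_spanB (Nat.lt_succ_self m)))

theorem sub_opB_mem_spanB (hn : 0 < n) (hL : IsNormalForm n L) {m : ℕ} {A : DiffOp K}
    (hA : A ∈ centralizerOp L) (hm : A.1.OrderLE m) (hm1 : A.1.coeff m = 1) :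
    A - opB n L m ∈ spanB n L {j | j < m} := by
  obtain ⟨Q, hQ, hB⟩ := exists_isMonicRoot_opB hn hL
  have hA' : L.1 * A.1 = A.1 * L.1 := congrArg Subtype.val hA
  have hcomm : L.1 * Q ^ m = Q ^ m * L.1 := by rw [← hQ.2.2, ← pow_add, ← pow_add, add_comm]
  have hQm := hQ.2.1.pow m
  have hQm' := PseudoDiffOp.coeff_pow_top hQ.2.1 m
  rw [mul_one] at hQm hQm'
  rw [hQ.1, one_pow] at hQm'
  have h := posPart_mem_spanB hn hL m (A := A.1 - Q ^ m)
    (by rw [mul_sub, sub_mul, hA', hcomm])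
    ((hm.sub hQm).pred (by rw [PseudoDiffOp.sub_coeff, hm1, hQm', sub_self]))
  have h3 : posPart A.1 = posPart (A.1 - Q ^ m) + opB n L m := by
    rw [hB, ← posPart_add, sub_add_cancel]
  rw [posPart_coe] at h3
  rwa [← sub_eq_iff_eq_add.2 h3] at h

/-- If j is the order of a monic A in Z(L), then B_j = A - (A - B_j), where A - B_j involves only
lower B_i. By induction on j such B_j are superfluous modulo the centralizer. -/
theorem spanB_le_sup (hn : 0 < n) (hL : IsNormalForm n L) (m : ℕ) :
    spanB n L {j | j < m} ≤ spanB n L (nonOrders L m) ⊔ centralizerLE L ((m : ℤ) - 1) := by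
  have key : ∀ j, j < m →
      opB n L j ∈ spanB n L (nonOrders L m) ⊔ centralizerLE L ((m : ℤ) - 1) := by
    intro j
    induction j using Nat.strong_induction_on with
    | _ j ih =>
      intro hj
      by_cases hW : j ∈ orderSet L
      · obtain ⟨A, hA, hAo, hA1⟩ := exists_monic_of_mem_orderSet hn hL hW
        have h1 : spanB n L {i | i < j} ≤
            spanB n L (nonOrders L m) ⊔ centralizerLE L ((m : ℤ) - 1) := by
          refine Submodule.span_le.2 ?_
          rintro _ ⟨i, hi, rfl⟩
          exact ih i hi (lt_trans hi hj)
        have h2 : A ∈ centralizerLE L ((m : ℤ) - 1) := ⟨hA, hAo.mono (by omega)⟩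
        have := sub_mem (Submodule.mem_sup_right (S := spanB n L (nonOrders L m)) h2)
          (h1 (sub_opB_mem_spanB hn hL hA hAo hA1))
        rwa [sub_sub_cancel] at this
      · exact Submodule.mem_sup_left
          (opB_mem_spanB (Finset.mem_coe.2 (mem_nonOrders.2 ⟨hj, hW⟩)))
  refine Submodule.span_le.2 ?_
  rintro _ ⟨i, hi, rfl⟩
  exact key i hi

/-- For A monic of order m in Z(L), write A - B_m = Y + Z, with Y a combination of B_j over
non-orders and Z in Z(L) of lower order. Then A - Z = B_m + Y provides the solution. -/
theorem exists_isGDSolution (hn : 0 < n) (hL : IsNormalForm n L) {m : ℕ} (hm : m ∈ orderSet L) :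
    ∃ ξ, IsGDSolution n L m (nonOrders L m) ξ := by
  obtain ⟨A, hA, hAo, hA1⟩ := exists_monic_of_mem_orderSet hn hL hm
  obtain ⟨Y, hY, Z, hZ, hYZ⟩ := Submodule.mem_sup.1
    (spanB_le_sup hn hL m (sub_opB_mem_spanB hn hL hA hAo hA1))
  obtain ⟨ξ, hξ⟩ := mem_spanB_finset.1 hY
  refine ⟨ξ, (isGDSolution_iff hn hL _ _ _).2 ?_⟩
  have : combB n L m (nonOrders L m) ξ = A - Z := by
    rw [combB, hξ, eq_sub_iff_add_eq, add_assoc, hYZ, add_sub_cancel]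
  rw [this]
  exact sub_mem_centralizerOp hA hZ.1

theorem exists_hasOrder_sum_opB (hn : 0 < n) (hL : IsNormalForm n L) {J : Finset ℕ}
    {ξ : J → constants K} (hξ : ξ ≠ 0) : ∃ j : J, (∑ j, ξ j • opB n L j.1).1.HasOrder j.1 := by
  have hw : ∀ j : J, ξ j • opB n L j.1 ≠ 0 → (ξ j • opB n L j.1).1.HasOrder (j.1 : ℤ) := by
    intro j hj
    refine ⟨?_, fun i hi => by rw [smul_coeff, opB_orderLE hn hL j.1 i hi, mul_zero]⟩
    rw [smul_coeff, opB_coeff_self hn hL, mul_one]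
    intro h
    exact hj (by rw [Subtype.ext (a1 := ξ j) (a2 := 0) h, zero_smul])
  obtain ⟨j, hj⟩ := Function.ne_iff.1 hξ
  have hne : ξ j • opB n L j.1 ≠ 0 := fun h0 => by
    have h1 := congrArg (fun A : DiffOp K => A.1.coeff j.1) h0
    simp only [smul_coeff, opB_coeff_self hn hL, mul_one] at h1
    exact hj (Subtype.ext h1)
  obtain ⟨i, -, hi⟩ := exists_hasOrder_sum (fun j : J => ξ j • opB n L j.1) (fun j => (j.1 : ℤ)) hw
    (fun i j _ _ h => Subtype.ext (Int.ofNat_inj.1 h)) ⟨j, hne⟩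
  exact ⟨i, hi⟩

/-- The difference of two solutions gives a combination of the B_j that lies in Z(L). Were it
nontrivial, its order would be one of the j, which are not orders. -/
theorem isGDSolution_unique (hn : 0 < n) (hL : IsNormalForm n L) {m : ℕ}
    {ξ ξ' : nonOrders L m → constants K} (h : IsGDSolution n L m (nonOrders L m) ξ)
    (h' : IsGDSolution n L m (nonOrders L m) ξ') : ξ = ξ' := by
  by_contra hne
  obtain ⟨j, hj⟩ := exists_hasOrder_sum_opB hn hL (sub_ne_zero.2 hne)
  refine (mem_nonOrders.1 j.2).2 ⟨_, ?_, hj⟩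
  have := sub_mem_centralizerOp ((isGDSolution_iff hn hL _ _ _).1 h) ((isGDSolution_iff hn hL _ _ _).1 h')
  simp only [Pi.sub_apply, sub_smul, Finset.sum_sub_distrib]
  rwa [combB, combB, add_sub_add_left_eq_sub] at this

theorem combB_hasOrder (hn : 0 < n) (hL : IsNormalForm n L) {m : ℕ} {J : Finset ℕ}
    (hJ : ∀ j ∈ J, j < m) (ξ : J → constants K) : (combB n L m J ξ).1.HasOrder m := by
  have h : ∀ i : ℤ, m ≤ i → (∑ j, ξ j • opB n L j.1).1.coeff i = 0 := by
    intro i hi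
    rw [sum_coeff]
    refine Finset.sum_eq_zero fun j _ => ?_
    rw [smul_coeff, opB_orderLE hn hL j.1 i (by have := hJ j.1 j.2; omega), mul_zero]
  refine ⟨?_, fun i hi => ?_⟩
  · rw [combB, add_coeff, h m le_rfl, opB_coeff_self hn hL, add_zero]; exact one_ne_zero
  · rw [combB, add_coeff, h i hi.le, opB_orderLE hn hL m i hi, add_zero]

/-- If the system at `m` with unknowns indexed by `J` has a unique solution, then no `w ∈ J`
such that `J` contains all non-orders below `w` is the order of an element of the centralizer. -/
theorem not_mem_orderSet_of_unique (hn : 0 < n) (hL : IsNormalForm n L) {m w : ℕ} {J : Finset ℕ}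
    {c : J → constants K} (hc : ∀ ξ, IsGDSolution n L m J ξ ↔ ξ = c) (hw : w ∈ J)
    (hJ : nonOrders L w ⊆ J) : w ∉ orderSet L := by
  intro hW
  obtain ⟨ξ, hξ⟩ := exists_isGDSolution hn hL hW
  rw [isGDSolution_iff hn hL] at hξ
  have hc' := (isGDSolution_iff hn hL _ _ _).1 ((hc c).2 rfl)
  -- The element of Z(L) of order w is itself a combination of the B_j with j in J; adding its
  -- coefficients η to c yields a second solution.
  have hmem : combB n L w (nonOrders L w) ξ ∈ spanB n L J :=
    add_mem (opB_mem_spanB hw) (spanB_mono hJ (mem_spanB_finset.2 ⟨ξ, rfl⟩))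
  obtain ⟨η, hη⟩ := mem_spanB_finset.1 hmem
  have h1 : IsGDSolution n L m J (c + η) := by
    rw [isGDSolution_iff hn hL]
    have := add_mem hc' hξ
    rw [← hη, combB, add_assoc, ← Finset.sum_add_distrib] at this
    simpa only [combB, Pi.add_apply, add_smul] using this
  have h2 : η = 0 := by simpa using (hc _).1 h1
  have h3 := (combB_hasOrder hn hL (fun j hj => (mem_nonOrders.1 hj).1) ξ).1
  rw [← hη, h2] at h3
  exact h3 (by simp; rfl)

end GelfandDickey

/-! ### Orders modulo n and linear independence over C[L] -/

section PolyRing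
variable {K : Type*} [Field K] [Differential K] {n : ℕ} {L : DiffOp K}

theorem self_mem_polyRing : L ∈ polyRing L := Algebra.self_mem_adjoin_singleton _ L

theorem polyRing_hasOrder (hn : 0 < n) (hL : IsNormalForm n L) {p : DiffOp K}
    (hp : p ∈ polyRing L) (h0 : p ≠ 0) : ∃ h : ℕ, p.1.HasOrder (h * n : ℕ) := by
  rw [polyRing, Algebra.adjoin_singleton_eq_range_aeval] at hp
  obtain ⟨f, rfl⟩ := hp
  change Polynomial.aeval L f ≠ 0 at h0
  change ∃ h : ℕ, (Polynomial.aeval L f).1.HasOrder (h * n : ℕ)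
  rw [Polynomial.aeval_eq_sum_range, ← Fin.sum_univ_eq_sum_range (fun i => f.coeff i • L ^ i)] at *
  have hw : ∀ i : Fin (f.natDegree + 1), f.coeff i • L ^ (i : ℕ) ≠ 0 →
      (f.coeff i • L ^ (i : ℕ)).1.HasOrder (i * n : ℕ) := by
    intro i hi
    have h1 := pow_hasOrder hL.hasOrder (i : ℕ)
    refine ⟨?_, fun j hj => by rw [smul_coeff, h1.2 j hj, mul_zero]⟩
    rw [smul_coeff]
    refine mul_ne_zero (fun h => hi ?_) h1.1
    rw [Subtype.ext (a1 := f.coeff i) (a2 := 0) h, zero_smul]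
  have hne : ∃ i : Fin (f.natDegree + 1), f.coeff i • L ^ (i : ℕ) ≠ 0 := by
    by_contra! hc
    exact h0 (Finset.sum_eq_zero fun i _ => hc i)
  obtain ⟨i, -, hi⟩ := exists_hasOrder_sum _ _ hw (fun i j _ _ h => Fin.ext
    (Nat.eq_of_mul_eq_mul_right hn (Int.ofNat_inj.1 h))) hne
  exact ⟨i, hi⟩

theorem mul_polyRing_hasOrder (hn : 0 < n) (hL : IsNormalForm n L) {p A : DiffOp K} {m : ℕ}
    (hp : p ∈ polyRing L) (h0 : p ≠ 0) (hA : A.1.HasOrder m) :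
    ∃ w : ℕ, (p * A).1.HasOrder w ∧ w ≡ m [MOD n] ∧ m ≤ w := by
  obtain ⟨h, hh⟩ := polyRing_hasOrder hn hL hp h0
  exact ⟨h * n + m, by rw [Nat.cast_add]; exact hh.mul hA, by simp [Nat.ModEq], by omega⟩

theorem exists_smul_hasOrder (hL : IsNormalForm n L) {X : DiffOp K} {q w : ℕ}
    (hX : X.1.HasOrder q) (hqw : q ≤ w) (h : w ≡ q [MOD n]) :
    ∃ p : polyRing L, (p • X).1.HasOrder w := by
  obtain ⟨k, hk⟩ := (Nat.modEq_iff_dvd' hqw).1 h.symm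
  refine ⟨⟨L ^ k, pow_mem self_mem_polyRing k⟩, ?_⟩
  have h1 := (pow_hasOrder hL.hasOrder k).mul hX
  rw [← Nat.cast_add, mul_comm, ← hk, Nat.sub_add_cancel hqw] at h1
  exact h1

/-- Multiplication by a nonzero element of C[L] raises the order by a multiple of n. The nonzero
products thus have incongruent, hence distinct, orders. -/
theorem exists_order_of_sum {ι : Type*} [Fintype ι] (hn : 0 < n) (hL : IsNormalForm n L)
    {G : ι → DiffOp K} {M : ι → ℕ} (hG : ∀ i, (G i).1.HasOrder (M i))
    (hM : ∀ i j, M i ≡ M j [MOD n] → i = j) (p : ι → DiffOp K) (hp : ∀ i, p i ∈ polyRing L)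
    (hne : ∃ i, p i ≠ 0) :
    ∃ i, ∃ w : ℕ, (∑ i, p i * G i).1.HasOrder w ∧ w ≡ M i [MOD n] ∧ M i ≤ w := by
  have h : ∀ i, ∃ w : ℕ, p i * G i ≠ 0 →
      (p i * G i).1.HasOrder w ∧ w ≡ M i [MOD n] ∧ M i ≤ w := by
    intro i
    by_cases h0 : p i = 0
    · exact ⟨0, fun hc => absurd (by rw [h0, zero_mul]) hc⟩
    · obtain ⟨w, hw⟩ := mul_polyRing_hasOrder hn hL (hp i) h0 (hG i)
      exact ⟨w, fun _ => hw⟩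
  choose w hw using h
  have hne' : ∃ i, p i * G i ≠ 0 := by
    obtain ⟨i, hi⟩ := hne
    obtain ⟨w, hw, -⟩ := mul_polyRing_hasOrder hn hL (hp i) hi (hG i)
    exact ⟨i, fun h => hw.ne_zero (congrArg Subtype.val h)⟩
  obtain ⟨i, hi, hi'⟩ := exists_hasOrder_sum (fun i => p i * G i) (fun i => (w i : ℤ))
    (fun i hi => (hw i hi).1) (fun i j hi hj hij => hM i j
      ((hw i hi).2.1.symm.trans (by rw [Int.ofNat_inj.1 hij]; exact (hw j hj).2.1))) hne'
  exact ⟨i, w i, hi', (hw i hi).2⟩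

theorem linearIndependent_of_incongruent {ι : Type*} [Fintype ι] (hn : 0 < n)
    (hL : IsNormalForm n L) {G : ι → DiffOp K} {M : ι → ℕ} (hG : ∀ i, (G i).1.HasOrder (M i))
    (hM : ∀ i j, M i ≡ M j [MOD n] → i = j) : LinearIndependent (polyRing L) G := by
  rw [Fintype.linearIndependent_iffₛ]
  intro f g hfg
  by_contra! hne
  obtain ⟨i, hi⟩ := hne
  obtain ⟨-, w, hw, -⟩ := exists_order_of_sum hn hL hG hM (fun i => (f i).1 - (g i).1)
    (fun i => sub_mem (f i).2 (g i).2) ⟨i, fun h => hi (Subtype.ext (sub_eq_zero.1 h))⟩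
  refine hw.ne_zero (congrArg Subtype.val ?_ : _ = (0 : DiffOp K).1)
  simp only [sub_mul, Finset.sum_sub_distrib]
  exact sub_eq_zero.2 hfg

theorem exists_order_of_mem_span {ι : Type*} [Fintype ι] (hn : 0 < n) (hL : IsNormalForm n L)
    {G : ι → DiffOp K} {M : ι → ℕ} (hG : ∀ i, (G i).1.HasOrder (M i))
    (hM : ∀ i j, M i ≡ M j [MOD n] → i = j) {A : DiffOp K}
    (hA : A ∈ Submodule.span (polyRing L) (Set.range G)) {m : ℕ} (hm : A.1.HasOrder m) :
    ∃ i, m ≡ M i [MOD n] ∧ M i ≤ m := by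
  obtain ⟨c, hc⟩ := (Submodule.mem_span_range_iff_exists_fun _).1 hA
  have hc' : ∑ i, (c i).1 * G i = A := hc
  have hne : ∃ i, (c i).1 ≠ 0 := by
    by_contra! h
    apply hm.ne_zero
    rw [← hc']
    simp [h]
  obtain ⟨i, w, hw, h⟩ := exists_order_of_sum hn hL hG hM _ (fun i => (c i).2) hne
  rw [hc'] at hw
  rw [Int.ofNat_inj.1 (hm.unique hw)]
  exact ⟨i, h⟩

/-- A `C[L]`-submodule, considered as a vector space over the constants. -/
noncomputable def constSubmodule (N : Submodule (polyRing L) (DiffOp K)) :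
    Submodule (constants K) (DiffOp K) where
  carrier := N
  add_mem' := N.add_mem
  zero_mem' := N.zero_mem
  smul_mem' c A hA := by
    rw [Algebra.smul_def]
    exact N.smul_mem (algebraMap (constants K) (polyRing L) c) hA

end PolyRing

/-! ### Class-minimal orders and reduced operators -/

section ClassMin
variable {K : Type*} [Field K] [Differential K] {n : ℕ} {L : DiffOp K}

/-- The orders of elements of the centralizer which are minimal in their class modulo `n`. -/
def classMin (n : ℕ) (L : DiffOp K) : Set ℕ :=
  {m | m ∈ orderSet L ∧ ∀ q ∈ orderSet L, q ≡ m [MOD n] → m ≤ q}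

theorem exists_classMin {w : ℕ} (hw : w ∈ orderSet L) :
    ∃ q ∈ classMin n L, q ≡ w [MOD n] ∧ q ≤ w := by
  classical
  have hex : ∃ q, q ∈ orderSet L ∧ q ≡ w [MOD n] := ⟨w, hw, rfl⟩
  exact ⟨Nat.find hex, ⟨(Nat.find_spec hex).1, fun q hq hqw => Nat.find_min' hex
    ⟨hq, hqw.trans (Nat.find_spec hex).2⟩⟩, (Nat.find_spec hex).2, Nat.find_min' hex ⟨hw, rfl⟩⟩

theorem classMin_unique {q q' : ℕ} (hq : q ∈ classMin n L) (hq' : q' ∈ classMin n L)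
    (h : q ≡ q' [MOD n]) : q = q' :=
  le_antisymm (hq.2 _ hq'.1 h.symm) (hq'.2 _ hq.1 h)

theorem zero_mem_classMin : 0 ∈ classMin n L := ⟨zero_mem_orderSet, fun _ _ _ => Nat.zero_le _⟩

/-- The orders are exactly the translates of the class minima by nonnegative multiples of n. Entries
q ≥ m of the list exclude no j < m, so the list may be the complete list of orders of a basis as
well as a partial one. -/
theorem optIndex_eq_nonOrders (hL : IsNormalForm n L) {m : ℕ} {l : List ℕ}
    (hl : ∀ q < m, q ∈ l ↔ q ∈ classMin n L) : optIndex n m l = nonOrders L m := by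
  ext j
  rw [mem_nonOrders, optIndex, Finset.mem_filter, Finset.mem_range, and_congr_right_iff]
  refine fun hj => ⟨fun h hW => ?_, fun h q hq hqj => h ?_⟩
  · obtain ⟨q, hq, hqw, hqj⟩ := exists_classMin (n := n) hW
    exact h q ((hl q (by omega)).2 hq) ⟨hqj, hqw.symm⟩
  · exact mem_orderSet_of_le hL ((hl q (by omega)).1 hq).1 hqj.1 hqj.2.symm

theorem isOrderMinimal_iff {X : DiffOp K} : IsOrderMinimal n L X ↔
    X ∈ centralizerOp L ∧ ∃ m ∈ classMin n L, X.1.HasOrder m := by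
  constructor
  · rintro ⟨hX, m, hm, h⟩
    exact ⟨hX, m, ⟨⟨X, hX, hm⟩, fun q ⟨Q, hQ, hq⟩ hqm => h Q hQ q hq hqm⟩, hm⟩
  · rintro ⟨hX, m, hm, h⟩
    exact ⟨hX, m, h, fun Q hQ q hq hqm => hm.2 q ⟨Q, hQ, hq⟩ hqm⟩

/-- `X` is the operator of order `m` given by the unique solution of the system at `m` whose
unknowns are indexed by the non-orders below `m`. -/
def IsReducedOp (n : ℕ) (L : DiffOp K) (m : ℕ) (X : DiffOp K) : Prop :=
  ∃ c : nonOrders L m → constants K, (∀ ξ, IsGDSolution n L m (nonOrders L m) ξ ↔ ξ = c) ∧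
    X = combB n L m (nonOrders L m) c

theorem IsReducedOp.unique {m : ℕ} {X X' : DiffOp K} (h : IsReducedOp n L m X)
    (h' : IsReducedOp n L m X') : X = X' := by
  obtain ⟨c, hc, rfl⟩ := h
  obtain ⟨c', hc', rfl⟩ := h'
  rw [(hc' c).1 ((hc c).2 rfl)]

variable [CharZero K]

theorem isReducedOp_of_solution (hn : 0 < n) (hL : IsNormalForm n L) {m : ℕ}
    {ξ : nonOrders L m → constants K} (h : IsGDSolution n L m (nonOrders L m) ξ) :
    IsReducedOp n L m (combB n L m (nonOrders L m) ξ) :=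
  ⟨ξ, fun _ => ⟨fun h' => isGDSolution_unique hn hL h' h, fun h' => h' ▸ h⟩, rfl⟩

theorem IsReducedOp.mem_centralizerOp (hn : 0 < n) (hL : IsNormalForm n L) {m : ℕ} {X : DiffOp K}
    (h : IsReducedOp n L m X) : X ∈ centralizerOp L := by
  obtain ⟨c, hc, rfl⟩ := h
  exact (isGDSolution_iff hn hL _ _ _).1 ((hc c).2 rfl)

theorem IsReducedOp.hasOrder (hn : 0 < n) (hL : IsNormalForm n L) {m : ℕ} {X : DiffOp K}
    (h : IsReducedOp n L m X) : X.1.HasOrder m := by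
  obtain ⟨c, hc, rfl⟩ := h
  exact combB_hasOrder hn hL (fun j hj => (mem_nonOrders.1 hj).1) c

theorem isReducedOp_zero_one (hn : 0 < n) (hL : IsNormalForm n L) : IsReducedOp n L 0 (1 : DiffOp K) := by
  have h : ∀ ξ : nonOrders L 0 → constants K, combB n L 0 (nonOrders L 0) ξ = 1 := by
    intro ξ
    rw [combB, opB_zero hn hL, Finset.sum_eq_zero, add_zero]
    intro j
    exact absurd (mem_nonOrders.1 j.2).1 (Nat.not_lt_zero _)
  have h0 : IsGDSolution n L 0 (nonOrders L 0) 0 := by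
    rw [isGDSolution_iff hn hL, h]
    exact one_mem_centralizerOp
  rw [← h 0]
  exact isReducedOp_of_solution hn hL h0

/-- A submodule containing elements of all class-minimal orders up to `b` contains all elements of
the centralizer of order up to `b`. -/
theorem mem_of_forall_classMin (hn : 0 < n) (hL : IsNormalForm n L)
    {N : Submodule (polyRing L) (DiffOp K)} {b : ℕ}
    (h : ∀ q ∈ classMin n L, q ≤ b → ∃ X ∈ N, X ∈ centralizerOp L ∧ X.1.HasOrder q)
    {A : DiffOp K} (hA : A ∈ centralizerOp L) (hb : A.1.OrderLE b) : A ∈ N := by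
  refine mem_of_forall_hasOrder hn hL (constSubmodule N) (constSubmodule (centralizerOp L))
    (fun _ h => h) (b + 1) ?_ hA (by push_cast; rwa [add_sub_cancel_right])
  intro w hw hW
  obtain ⟨q, hq, hqw, hle⟩ := exists_classMin (n := n) (w := w) hW
  obtain ⟨X, hX, hXZ, hXo⟩ := h q hq (by omega)
  obtain ⟨p, hp⟩ := exists_smul_hasOrder hL hXo hle hqw.symm
  exact ⟨p • X, N.smul_mem p hX, (centralizerOp L).smul_mem p hXZ, hp⟩

end ClassMin

/-! ### The level and the bound (d - 1)M -/

/-- Write the gcd as nx + My (Bézout) and r as t times the gcd; then r ≡ (ty)M modulo n. As dM is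
divisible by n for d = n / (n, M), the factor ty may be reduced modulo d. -/
theorem exists_lt_modEq_mul {n M r : ℕ} (hn : 0 < n) (hr : n.gcd M ∣ r) :
    ∃ j < n / n.gcd M, r ≡ j * M [MOD n] := by
  obtain ⟨t, rfl⟩ := hr
  have hg : 0 < n.gcd M := Nat.gcd_pos_of_pos_left _ hn
  obtain ⟨d, hd⟩ := Nat.gcd_dvd_left n M
  obtain ⟨e, he⟩ := Nat.gcd_dvd_right n M
  have hdiv : n / n.gcd M = d := Nat.div_eq_of_eq_mul_right hg hd
  have hd0 : 0 < d := Nat.pos_of_ne_zero fun h => by rw [h, mul_zero] at hd; omega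
  rw [hdiv]
  have hlt := Int.emod_lt_of_pos (n.gcdB M * t) (Int.natCast_pos.2 hd0)
  have hnn := Int.emod_nonneg (n.gcdB M * t) (Int.natCast_pos.2 hd0).ne'
  refine ⟨((n.gcdB M * t) % d).toNat, by omega, ?_⟩
  rw [← Int.natCast_modEq_iff, Nat.cast_mul, Nat.cast_mul, Int.toNat_of_nonneg hnn]
  have h1 := Nat.gcd_eq_gcd_ab n M
  have h2 : (n : ℤ) = n.gcd M * d := by exact_mod_cast hd
  have h3 : (M : ℤ) = n.gcd M * e := by exact_mod_cast he
  have h4 := Int.emod_add_mul_ediv (n.gcdB M * t) d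
  rw [Int.modEq_iff_dvd]
  -- This is (jM - r)/n: the first term comes from Bézout, the second from reducing modulo d, with
  -- dM = en.
  refine ⟨-(t * n.gcdA M) - e * (n.gcdB M * t / d), ?_⟩
  linear_combination (M : ℤ) * h4 - (t : ℤ) * h1 + e * (n.gcdB M * t / d) * h2 -
    d * (n.gcdB M * t / d) * h3

section Level
variable {K : Type*} [Field K] [Differential K] {n M : ℕ} {L : DiffOp K}

theorem IsLevel.dvd_of_lt (hn : 0 < n) (hL : IsNormalForm n L) (hM : IsLevel L M) {w : ℕ}
    (hw : w ∈ orderSet L) (hwM : w < M) : n ∣ w := by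
  obtain ⟨A, hA, hAo⟩ := hw
  have hAp : A ∈ polyRing L := by
    by_contra hAp
    have := hM.2 (show w ∈ {m : ℕ | ¬ ∀ A ∈ centralizerLE L m, A ∈ polyRing L} from
      fun h => hAp (h A ⟨hA, hAo.2⟩))
    omega
  obtain ⟨h, hh⟩ := polyRing_hasOrder hn hL hAp fun h => hAo.ne_zero (congrArg Subtype.val h)
  exact ⟨h, by rw [Int.ofNat_inj.1 (hAo.unique hh), mul_comm]⟩

variable [CharZero K]

/-- By minimality, an element of Z_M outside C[L] has order exactly M. If n divided M, subtracting a
constant multiple of a power of L would lower the order while staying outside C[L]. -/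
theorem IsLevel.mem_orderSet_and_not_dvd (hn : 0 < n) (hL : IsNormalForm n L)
    (hM : IsLevel L M) : M ∈ orderSet L ∧ ¬ n ∣ M := by
  have hlow : ∀ A ∈ centralizerOp L, A ∉ polyRing L → ∀ m : ℕ, A.1.HasOrder m → M ≤ m :=
    fun A hA hAp m hm => hM.2 fun h => hAp (h A ⟨hA, hm.2⟩)
  obtain ⟨A, hA, hAp⟩ : ∃ A ∈ centralizerLE L M, A ∉ polyRing L := by
    have := hM.1
    simp only [Set.mem_ofPred_eq] at this
    push Not at this
    exact this
  have hA0 : ∀ {B : DiffOp K}, B ∉ polyRing L → B ≠ 0 := fun hB h => hB (h ▸ zero_mem _)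
  obtain ⟨m, hm⟩ := exists_hasOrder (hA0 hAp)
  have hmM : m = M := le_antisymm (by exact_mod_cast hm.le hA.2) (hlow A hA.1 hAp m hm)
  subst hmM
  refine ⟨⟨A, hA.1, hm⟩, fun ⟨k, hk⟩ => ?_⟩
  have hLp : L ^ k ∈ polyRing L := pow_mem self_mem_polyRing k
  have hLZ : L ^ k ∈ centralizerOp L := pow_mem_centralizerOp rfl k
  have hLo := pow_hasOrder hL.hasOrder k
  rw [mul_comm, ← hk] at hLo
  obtain ⟨c, hc⟩ := exists_smul_sub_orderLE hn hL hA.1 hLZ hm.2 hLo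
  have hp : A - c • L ^ k ∉ polyRing L := fun h => hAp (by
    have := add_mem h (Subalgebra.smul_mem _ hLp c)
    rwa [sub_add_cancel] at this)
  obtain ⟨w, hw⟩ := exists_hasOrder (hA0 hp)
  have h1 := hlow _ (sub_mem_centralizerOp hA.1 (smul_mem_centralizerOp c hLZ)) hp w hw
  have h2 := hw.le hc
  omega

/-- Every class modulo `n` of multiples of `(n, M)` contains a class-minimal order, which is at
most `(n / (n, M) - 1) M`. -/
theorem IsLevel.exists_classMin_le (hn : 0 < n) (hL : IsNormalForm n L) (hM : IsLevel L M) {r : ℕ}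
    (hr : n.gcd M ∣ r) : ∃ q ∈ classMin n L, q ≡ r [MOD n] ∧ q ≤ (n / n.gcd M - 1) * M := by
  obtain ⟨j, hj, hjr⟩ := exists_lt_modEq_mul hn hr
  -- The multiple jM is itself an order, so it bounds the minimum of its class.
  obtain ⟨q, hq, hqj, hle⟩ := exists_classMin (n := n)
    (mul_mem_orderSet j (hM.mem_orderSet_and_not_dvd hn hL).1)
  exact ⟨q, hq, hqj.trans hjr.symm, hle.trans (Nat.mul_le_mul_right M (by omega))⟩

end Level

/-! ### Correctness of the algorithm -/

section Algorithm
variable {K : Type*} [Field K] [Differential K] {n M : ℕ} {L : DiffOp K}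

/-- The state of the algorithm before the pass at `m`: the list consists of the reduced operators
of the class-minimal orders below `m`, ordered by their orders. -/
structure IsState (n : ℕ) (L : DiffOp K) (m : ℕ) (st : List (ℕ × DiffOp K)) : Prop where
  sorted : (st.map Prod.fst).Pairwise (· < ·)
  mem_iff : ∀ q, q ∈ st.map Prod.fst ↔ q ∈ classMin n L ∧ q < m
  reduced : ∀ p ∈ st, IsReducedOp n L p.1 p.2
  head : (st.map Prod.snd).head? = some 1

/-- The family `G` consists of the reduced operators of orders `ord`, which are strictly
increasing, class-minimal, and include all class-minimal orders up to `b`. -/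
structure IsReducedFamily (n : ℕ) (L : DiffOp K) (b : ℕ) (G : List (DiffOp K))
    (ord : Fin G.length → ℕ) : Prop where
  strictMono : StrictMono ord
  mem : ∀ i, ord i ∈ classMin n L
  exists_eq : ∀ q ∈ classMin n L, q ≤ b → ∃ i, ord i = q
  reduced : ∀ i, IsReducedOp n L (ord i) (G.get i)

theorem IsState.exists_isReducedFamily {m b : ℕ} {st : List (ℕ × DiffOp K)} (hb : b < m)
    (h : IsState n L m st) : ∃ ord, IsReducedFamily n L b (st.map Prod.snd) ord := by
  have hlen : (st.map Prod.snd).length = st.length := List.length_map _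
  have hmem : ∀ i : Fin st.length, (st.get i).1 ∈ st.map Prod.fst := fun i =>
    List.mem_map_of_mem (List.get_mem _ _)
  refine ⟨fun i => (st.get (i.cast hlen)).1, fun i j hij => ?_, fun i => ?_, fun q hq hqb => ?_,
    fun i => ?_⟩
  · have := List.pairwise_iff_get.1 (List.pairwise_map.1 h.sorted) (i.cast hlen) (j.cast hlen) hij
    exact this
  · exact ((h.mem_iff _).1 (hmem _)).1
  · obtain ⟨p, hp, hpq⟩ := List.mem_map.1 ((h.mem_iff q).2 ⟨hq, by omega⟩)
    obtain ⟨i, hi⟩ := List.mem_iff_get.1 hp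
    exact ⟨i.cast hlen.symm, by rw [← hpq, ← hi]; rfl⟩
  · have := h.reduced _ (List.get_mem st (i.cast hlen))
    simpa using this

theorem IsReducedFamily.eq_of_modEq {b : ℕ} {G : List (DiffOp K)} {ord : Fin G.length → ℕ}
    (h : IsReducedFamily n L b G ord) (i j : Fin G.length)
    (hij : ord i ≡ ord j [MOD n]) : i = j :=
  h.strictMono.injective (classMin_unique (h.mem i) (h.mem j) hij)

variable [CharZero K]

/-- Below the level only multiples of n are orders, so 0 is the only class minimum there; and M > 0
because n does not divide M. -/
theorem IsLevel.isState_init (hn : 0 < n) (hL : IsNormalForm n L) (hM : IsLevel L M) :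
    IsState n L M [(0, 1)] where
  sorted := by simp
  mem_iff q := by
    simp only [List.map_cons, List.map_nil, List.mem_singleton]
    constructor
    · rintro rfl
      refine ⟨zero_mem_classMin, Nat.pos_of_ne_zero ?_⟩
      rintro rfl
      exact (hM.mem_orderSet_and_not_dvd hn hL).2 (dvd_zero n)
    · rintro ⟨hq, hqM⟩
      have := hM.dvd_of_lt hn hL hq.1 hqM
      exact classMin_unique hq zero_mem_classMin ((Nat.modEq_zero_iff_dvd).2 this)
  reduced p hp := by
    rw [List.mem_singleton.1 hp]
    exact isReducedOp_zero_one hn hL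
  head := rfl

/-- The invariant identifies the unknowns with the non-orders below m, so the solver succeeds
exactly when m is an order, and its answer is forced. The congruence test has already discarded the
orders that are not minimal in their class. -/
theorem IsState.step (S : ConstSolver K) (hn : 0 < n) (hL : IsNormalForm n L) {m : ℕ}
    {st : List (ℕ × DiffOp K)} (h : IsState n L m st) :
    IsState n L (m + 1) (filteredStep S n L st m) := by
  have hskip : m ∉ classMin n L → IsState n L (m + 1) st := fun hm =>
    { h with
      mem_iff := fun q => by
        rw [h.mem_iff, and_congr_right_iff]
        intro hq
        have : q ≠ m := fun hqm => hm (hqm ▸ hq)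
        omega }
  have hopt : optIndex n m (st.map Prod.fst) = nonOrders L m :=
    optIndex_eq_nonOrders hL fun q hq => by rw [h.mem_iff]; simp [hq]
  rw [filteredStep]
  split_ifs with hex
  · obtain ⟨p, hp, hpm⟩ := hex
    have hp' := (h.mem_iff p.1).1 (List.mem_map_of_mem hp)
    refine hskip fun hm => ?_
    have := classMin_unique hm hp'.1 hpm
    omega
  · have hsol : m ∈ orderSet L → ∃ ξ, IsGDSolution n L m (optIndex n m (st.map Prod.fst)) ξ := by
      rw [hopt]; exact exists_isGDSolution hn hL
    have hcomb : ∀ ξ, IsGDSolution n L m (optIndex n m (st.map Prod.fst)) ξ →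
        IsReducedOp n L m (combB n L m (optIndex n m (st.map Prod.fst)) ξ) := by
      rw [hopt]; exact fun ξ => isReducedOp_of_solution hn hL
    split
    · next hs =>
      exact hskip fun hm => S.complete _ _ _ _ hs (hsol hm.1)
    · next ξ hs =>
      have hred := hcomb ξ (S.sound _ _ _ _ _ hs)
      have hW : m ∈ orderSet L := ⟨_, hred.mem_centralizerOp hn hL, hred.hasOrder hn hL⟩
      -- A smaller minimum of the class of m would already be in the list, and the congruence test
      -- would have skipped m.
      have hm : m ∈ classMin n L := by
        obtain ⟨q, hq, hqm, hle⟩ := exists_classMin (n := n) hW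
        rcases hle.eq_or_lt with rfl | hlt
        · exact hq
        · obtain ⟨p, hp, hpq⟩ := List.mem_map.1 ((h.mem_iff q).2 ⟨hq, hlt⟩)
          exact absurd ⟨p, hp, by rw [hpq]; exact hqm.symm⟩ hex
      refine ⟨?_, fun q => ?_, fun p hp => ?_, ?_⟩
      · rw [List.map_append, List.pairwise_append]
        refine ⟨h.sorted, by simp, fun a ha b hb => ?_⟩
        simp only [List.map_cons, List.map_nil, List.mem_singleton] at hb
        rw [hb]
        exact ((h.mem_iff a).1 ha).2
      · rw [List.map_append, List.mem_append, h.mem_iff]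
        simp only [List.map_cons, List.map_nil, List.mem_singleton]
        constructor
        · rintro (⟨hq, hlt⟩ | rfl)
          · exact ⟨hq, by omega⟩
          · exact ⟨hm, by omega⟩
        · rintro ⟨hq, hlt⟩
          rcases eq_or_ne q m with rfl | hne
          · exact Or.inr rfl
          · exact Or.inl ⟨hq, by omega⟩
      · rcases List.mem_append.1 hp with hp | hp
        · exact h.reduced p hp
        · rw [List.mem_singleton.1 hp]
          exact hred
      · rw [List.map_append, List.head?_append, h.head]
        rfl

theorem IsState.foldl (S : ConstSolver K) (hn : 0 < n) (hL : IsNormalForm n L) (k : ℕ) {m : ℕ}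
    {st : List (ℕ × DiffOp K)} (h : IsState n L m st) :
    IsState n L (m + k) ((List.range' m k).foldl (filteredStep S n L) st) := by
  induction k generalizing m st with
  | zero => exact h
  | succ k ih =>
    rw [List.range'_succ, List.foldl_cons, show m + (k + 1) = m + 1 + k by omega]
    exact ih (h.step S hn hL)

namespace IsReducedFamily
variable {b : ℕ} {G : List (DiffOp K)} {ord : Fin G.length → ℕ}

theorem exists_get (hn : 0 < n) (hL : IsNormalForm n L) (h : IsReducedFamily n L b G ord) {q : ℕ}
    (hq : q ∈ classMin n L) (hqb : q ≤ b) :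
    ∃ X ∈ Submodule.span (polyRing L) (Set.range fun i : Fin G.length => G.get i),
      X ∈ centralizerOp L ∧ X.1.HasOrder q := by
  obtain ⟨i, rfl⟩ := h.exists_eq q hq hqb
  exact ⟨G.get i, Submodule.subset_span ⟨i, rfl⟩, (h.reduced i).mem_centralizerOp hn hL,
    (h.reduced i).hasOrder hn hL⟩

theorem linearIndependent (hn : 0 < n) (hL : IsNormalForm n L) (h : IsReducedFamily n L b G ord) :
    LinearIndependent (polyRing L) fun i : Fin G.length => G.get i :=
  linearIndependent_of_incongruent hn hL (fun i => (h.reduced i).hasOrder hn hL) h.eq_of_modEq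

theorem span_le (hn : 0 < n) (hL : IsNormalForm n L) (h : IsReducedFamily n L b G ord) :
    Submodule.span (polyRing L) (Set.range fun i : Fin G.length => G.get i) ≤ centralizerOp L := by
  refine Submodule.span_le.2 ?_
  rintro _ ⟨i, rfl⟩
  exact (h.reduced i).mem_centralizerOp hn hL

end IsReducedFamily

theorem exists_isReducedFamily_filteredBasis (S : ConstSolver K) (hn : 0 < n)
    (hL : IsNormalForm n L) (hM : IsLevel L M) :
    (filteredBasis S n L M).head? = some 1 ∧ ∃ ord,
      IsReducedFamily n L ((n / n.gcd M - 1) * M) (filteredBasis S n L M) ord := by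
  -- The subtraction is truncated, but M + ((d - 1)M + 1 - M) exceeds (d - 1)M in every case.
  have h := (hM.isState_init hn hL).foldl S hn hL ((n / n.gcd M - 1) * M + 1 - M)
  exact ⟨h.head, h.exists_isReducedFamily (by omega)⟩

end Algorithm

/-! ### Filtered bases -/

section FilteredBasis
variable {K : Type*} [Field K] [Differential K] {n M : ℕ} {L : DiffOp K}

/-- Both order sequences are strictly increasing with the set of all class minima as range, hence
they coincide; a reduced operator is determined by its order. -/
theorem IsReducedFamily.eq {b : ℕ} {G G' : List (DiffOp K)} {ord : Fin G.length → ℕ}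
    {ord' : Fin G'.length → ℕ} (hb : ∀ q ∈ classMin n L, q ≤ b)
    (h : IsReducedFamily n L b G ord) (h' : IsReducedFamily n L b G' ord') : G = G' := by
  have hmem : ∀ q, q ∈ List.ofFn ord ↔ q ∈ List.ofFn ord' := fun q => by
    rw [List.mem_ofFn, List.mem_ofFn]
    constructor
    · rintro ⟨i, rfl⟩
      exact h'.exists_eq _ (h.mem i) (hb _ (h.mem i))
    · rintro ⟨i, rfl⟩
      exact h.exists_eq _ (h'.mem i) (hb _ (h'.mem i))
  have hs : (List.ofFn ord).Pairwise (· < ·) := List.pairwise_ofFn.2 fun _ _ hij => h.strictMono hij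
  have hs' : (List.ofFn ord').Pairwise (· < ·) :=
    List.pairwise_ofFn.2 fun _ _ hij => h'.strictMono hij
  have heq : List.ofFn ord = List.ofFn ord' :=
    ((List.perm_ext_iff_of_nodup (hs.imp ne_of_lt) (hs'.imp ne_of_lt)).2 hmem).eq_of_pairwise
      (fun a b _ _ hab hba => absurd hab (lt_asymm hba)) hs hs'
  have hlen : G.length = G'.length := by simpa using congrArg List.length heq
  refine List.ext_get hlen fun i hi hi' => ?_
  have hord : ord ⟨i, hi⟩ = ord' ⟨i, hi'⟩ := by
    have := List.getElem_of_eq heq (i := i) (by simpa using hi)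
    simpa using this
  exact (h.reduced ⟨i, hi⟩).unique (hord ▸ h'.reduced ⟨i, hi'⟩)

variable [CharZero K]

/-- The definition of a filtered basis does not mention class minima; they are recovered from the
uniqueness of the solutions together with the basis property. Since every class minimum occurs, b is
arbitrary. -/
theorem IsFilteredBasis.exists_isReducedFamily (hn : 0 < n) (hL : IsNormalForm n L)
    {G : List (DiffOp K)} (hG : IsFilteredBasis n L G) (b : ℕ) :
    ∃ ord, IsReducedFamily n L b G ord := by
  obtain ⟨⟨hli, hspan⟩, hhead, ord, hmono, hord, hGD⟩ := hG
  have hZ : ∀ i, G.get i ∈ centralizerOp L := fun i => by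
    rw [← hspan]; exact Submodule.subset_span ⟨i, rfl⟩
  have hW : ∀ i, ord i ∈ orderSet L := fun i => ⟨_, hZ i, hord i⟩
  have hone : ∀ i : Fin G.length, i.1 = 0 → G.get i = 1 := fun i hi => by
    rw [List.head?_eq_getElem?, List.getElem?_eq_some_iff] at hhead
    obtain ⟨hlt, he⟩ := hhead
    rw [show i = ⟨0, hlt⟩ from Fin.ext hi]
    exact he
  have h0 : ∀ i : Fin G.length, i.1 = 0 → ord i = 0 := fun i hi => by
    have h2 := hord i
    rw [hone i hi] at h2
    exact_mod_cast h2.unique one_hasOrder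
  -- An order w < M_i not of the form M_k + hn would be an index of the system at M_i, along with
  -- all non-orders below w, contradicting uniqueness.
  have hcover : ∀ i, ∀ w ∈ orderSet L, w < ord i → ∃ k, ord k ≤ w ∧ w ≡ ord k [MOD n] := by
    intro i w hw hwi
    by_cases hi : i.1 = 0
    · rw [h0 i hi] at hwi; omega
    · obtain ⟨-, c, hc, -⟩ := hGD i hi
      by_contra! hno
      refine not_mem_orderSet_of_unique hn hL hc (w := w) ?_ ?_ hw
      · rw [optIndex, Finset.mem_filter, Finset.mem_range]
        refine ⟨hwi, fun q hq hqw => ?_⟩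
        obtain ⟨k, rfl⟩ := List.mem_ofFn.1 hq
        exact hno k hqw.1 hqw.2
      · intro j hj
        rw [mem_nonOrders] at hj
        rw [optIndex, Finset.mem_filter, Finset.mem_range]
        refine ⟨by omega, fun q hq hqj => hj.2 ?_⟩
        obtain ⟨k, rfl⟩ := List.mem_ofFn.1 hq
        exact mem_orderSet_of_le hL (hW k) hqj.1 hqj.2.symm
  -- If M_i ≡ M_k with i < k, then M_k is not class-minimal and every class minimum up to M_k is the
  -- order of some G_j with j < k. Descent puts G_k in the span of the earlier operators, against
  -- independence.
  have hinc : ∀ i k, i < k → ¬ ord i ≡ ord k [MOD n] := by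
    intro i k hik hmod
    have : Nontrivial (polyRing L) := ⟨0, 1, fun h =>
      (one_hasOrder (K := K)).ne_zero (congrArg (fun p : polyRing L => p.1.1) h).symm⟩
    refine hli.notMem_span_image (s := {j | j < k}) (x := k) (lt_irrefl k) ?_
    refine mem_of_forall_classMin hn hL (b := ord k) ?_ (hZ k) (hord k).2
    intro q hq hqk
    have hex : ∃ j, j < k ∧ ord j = q := by
      rcases hqk.eq_or_lt with rfl | hlt
      · have := hq.2 _ (hW i) hmod
        exact absurd (hmono hik) (not_lt.2 this)
      · obtain ⟨j, hjq, hj⟩ := hcover k q hq.1 hlt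
        exact ⟨j, hmono.lt_iff_lt.1 (hjq.trans_lt hlt), le_antisymm hjq (hq.2 _ (hW j) hj.symm)⟩
    obtain ⟨j, hjk, rfl⟩ := hex
    exact ⟨G.get j, Submodule.subset_span ⟨j, hjk, rfl⟩, hZ j, hord j⟩
  have hinj : ∀ i k, ord i ≡ ord k [MOD n] → i = k := by
    intro i k hik
    rcases lt_trichotomy i k with h | h | h
    · exact absurd hik (hinc i k h)
    · exact h
    · exact absurd hik.symm (hinc k i h)
  have hmin : ∀ i, ord i ∈ classMin n L := by
    refine fun i => ⟨hW i, fun q hq hqi => ?_⟩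
    by_contra! hlt
    obtain ⟨k, hkq, hk⟩ := hcover i q hq hlt
    rw [hinj k i (hk.symm.trans hqi)] at hkq
    omega
  -- With incongruent orders known, an element of the span has an order congruent to, and at least,
  -- some M_i; a class minimum must equal it.
  have hall : ∀ q ∈ classMin n L, ∃ i, ord i = q := by
    intro q hq
    obtain ⟨A, hA, hAo⟩ := hq.1
    rw [← hspan] at hA
    obtain ⟨i, hi, hle⟩ := exists_order_of_mem_span hn hL hord hinj hA hAo
    exact ⟨i, le_antisymm hle (hq.2 _ (hW i) hi.symm)⟩
  refine ⟨ord, hmono, hmin, fun q hq _ => hall q hq, fun i => ?_⟩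
  by_cases hi : i.1 = 0
  · rw [h0 i hi]
    rw [hone i hi]
    exact isReducedOp_zero_one hn hL
  · have hopt : optIndex n (ord i) (List.ofFn ord) = nonOrders L (ord i) :=
      optIndex_eq_nonOrders hL fun q _ => by
        rw [List.mem_ofFn]
        exact ⟨fun ⟨k, hk⟩ => hk ▸ hmin k, hall q⟩
    have h2 := (hGD i hi).2
    rwa [hopt] at h2

/-- Spanning follows by descent through the class minima. The direct sum decomposition at M_i holds
because G_i has order M_i and the graded pieces have dimension at most one. -/
theorem IsReducedFamily.isFilteredBasis {b : ℕ} (hn : 0 < n) (hL : IsNormalForm n L)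
    {G : List (DiffOp K)} {ord : Fin G.length → ℕ} (hb : ∀ q ∈ classMin n L, q ≤ b)
    (h : IsReducedFamily n L b G ord) (hhead : G.head? = some 1) : IsFilteredBasis n L G := by
  have hord := fun i => (h.reduced i).hasOrder hn hL
  have hZ := fun i => (h.reduced i).mem_centralizerOp hn hL
  refine ⟨⟨h.linearIndependent hn hL, le_antisymm (h.span_le hn hL) fun A hA => ?_⟩, hhead, ord,
    h.strictMono, hord, fun i _ => ⟨⟨?_, ?_⟩, ?_⟩⟩
  · by_cases h0 : A = 0
    · rw [h0]; exact zero_mem _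
    · obtain ⟨m, hm⟩ := exists_hasOrder h0
      exact mem_of_forall_classMin hn hL (fun q hq _ => h.exists_get hn hL hq (hb q hq)) hA hm.2
  · rw [Submodule.disjoint_def]
    intro A hA hA'
    obtain ⟨c, rfl⟩ := Submodule.mem_span_singleton.1 hA'
    have h1 := hA.2 (ord i) (by omega)
    rw [smul_coeff] at h1
    rw [Subtype.ext (a1 := c) (a2 := 0) ((mul_eq_zero.1 h1).resolve_right (hord i).1), zero_smul]
  · refine le_antisymm (sup_le (fun A hA => ⟨hA.1, hA.2.mono (by omega)⟩) ?_) fun A hA => ?_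
    · rw [Submodule.span_singleton_le_iff_mem]
      exact ⟨hZ i, (hord i).2⟩
    · obtain ⟨c, hc⟩ := exists_smul_sub_orderLE hn hL hA.1 (hZ i) hA.2 (hord i)
      exact Submodule.mem_sup.2 ⟨_, ⟨sub_mem_centralizerOp hA.1 (smul_mem_centralizerOp c (hZ i)),
        hc⟩, _, Submodule.smul_mem _ c (Submodule.mem_span_singleton_self _), sub_add_cancel _ _⟩
  · have hopt : optIndex n (ord i) (List.ofFn ord) = nonOrders L (ord i) :=
      optIndex_eq_nonOrders hL fun q _ => by
        rw [List.mem_ofFn]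
        exact ⟨fun ⟨k, hk⟩ => hk ▸ h.mem k, fun hq => h.exists_eq q hq (hb q hq)⟩
    rw [hopt]
    exact h.reduced i

end FilteredBasis

/-! ### Maximal submodules of rank ρ -/

section MaximalSubmodule
variable {K : Type*} [Field K] [CharZero K] [Differential K] {n M : ℕ} {L : DiffOp K}

/-- Choose an operator of class-minimal order in each class kρ with k < d. These classes are
distinct since kρ < n. -/
theorem IsLevel.exists_isMaximalOfRank (hn : 0 < n) (hL : IsNormalForm n L) (hM : IsLevel L M) :
    ∃ N, IsMaximalOfRank n (n.gcd M) L N := by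
  obtain ⟨e, he⟩ : ∃ e, n / n.gcd M = e + 1 := Nat.exists_eq_succ_of_ne_zero
    (Nat.div_pos (Nat.gcd_le_left M hn) (Nat.gcd_pos_of_pos_left M hn)).ne'
  have hX : ∀ k : Fin e, ∃ X ∈ centralizerOp L, ∃ m ∈ classMin n L, X.1.HasOrder m ∧
      m ≡ (k + 1 : ℕ) * n.gcd M [MOD n] := by
    intro k
    obtain ⟨q, hq, hqk, -⟩ := hM.exists_classMin_le hn hL (Dvd.intro_left (k + 1 : ℕ) rfl)
    obtain ⟨X, hX, hXo⟩ := hq.1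
    exact ⟨X, hX, q, hq, hXo, hqk⟩
  choose X hXZ m hm hXo hmod using hX
  -- The class of 0 is treated apart, since its operator is required to be 1.
  let Y : Fin (e + 1) → DiffOp K := Fin.cons 1 X
  let w : Fin (e + 1) → ℕ := Fin.cons 0 m
  have hY : ∀ k, Y k ∈ centralizerOp L := Fin.cases one_mem_centralizerOp hXZ
  have hw : ∀ k, w k ∈ classMin n L := Fin.cases zero_mem_classMin hm
  have hYw : ∀ k, (Y k).1.HasOrder (w k) := Fin.cases one_hasOrder hXo
  have hwk : ∀ k : Fin (e + 1), w k ≡ k * n.gcd M [MOD n] :=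
    Fin.cases (by simp [w, Nat.ModEq]) fun k => by simpa [w] using hmod k
  have hnd : (e + 1) * n.gcd M = n := by rw [← he]; exact Nat.div_mul_cancel (Nat.gcd_dvd_left n M)
  have hg : 0 < n.gcd M := Nat.gcd_pos_of_pos_left M hn
  have hlt : ∀ k : Fin (e + 1), k * n.gcd M < n := fun k => by
    conv_rhs => rw [← hnd]
    exact Nat.mul_lt_mul_of_pos_right k.2 hg
  have hinj : ∀ i j, w i ≡ w j [MOD n] → i = j := by
    intro i j hij
    have := ((hwk i).symm.trans hij).trans (hwk j)
    exact Fin.ext (Nat.eq_of_mul_eq_mul_right hg (Nat.ModEq.eq_of_lt_of_lt this (hlt i) (hlt j)))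
  have hlen : (List.ofFn Y).length = e + 1 := List.length_ofFn
  have hget : ∀ k, (List.ofFn Y).get k = Y (k.cast hlen) := fun k => List.get_ofFn Y k
  refine ⟨_, List.ofFn Y, by rw [hlen, he], by simp [Y], fun k => ?_, ?_, rfl⟩
  · rw [hget]
    exact ⟨isOrderMinimal_iff.2 ⟨hY _, _, hw _, hYw _⟩, _, hYw _, hwk _⟩
  · refine linearIndependent_of_incongruent hn hL (M := fun k => w (k.cast hlen)) (fun k => ?_)
      fun i j hij => ?_
    · rw [hget]; exact hYw _
    · exact Fin.cast_injective hlen (hinj _ _ hij)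

/-- The basis operators have class-minimal orders at most (d - 1)M. Descent from such an operator
may pass through orders not divisible by ρ, but the family includes the class minima of all classes
up to this bound. -/
theorem IsMaximalOfRank.le (hn : 0 < n) (hL : IsNormalForm n L) (hM : IsLevel L M)
    {G : List (DiffOp K)} {ord : Fin G.length → ℕ}
    (h : IsReducedFamily n L ((n / n.gcd M - 1) * M) G ord)
    {N : Submodule (polyRing L) (DiffOp K)} (hN : IsMaximalOfRank n (n.gcd M) L N) :
    N ≤ Submodule.span (polyRing L) (Set.range fun i : Fin G.length => G.get i) := by
  obtain ⟨G', -, -, hmin, -, rfl⟩ := hN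
  refine Submodule.span_le.2 ?_
  rintro _ ⟨k, rfl⟩
  obtain ⟨hk, m, hm, hmk⟩ := hmin k
  obtain ⟨hZ, m', hm', hmo⟩ := isOrderMinimal_iff.1 hk
  obtain rfl : m' = m := Int.ofNat_inj.1 (hmo.unique hm)
  obtain ⟨q, hq, hqk, hle⟩ := hM.exists_classMin_le hn hL (Dvd.intro_left (k : ℕ) rfl)
  obtain rfl : q = m' := classMin_unique hq hm' (hqk.trans hmk.symm)
  exact mem_of_forall_classMin hn hL (fun r hr hrq => h.exists_get hn hL hr (hrq.trans hle)) hZ hm.2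

theorem IsReducedFamily.le_span_of_dvd (hn : 0 < n) (hL : IsNormalForm n L) (hM : IsLevel L M)
    {G : List (DiffOp K)} {ord : Fin G.length → ℕ}
    (h : IsReducedFamily n L ((n / n.gcd M - 1) * M) G ord)
    {N : Submodule (polyRing L) (DiffOp K)}
    (hN : ∀ Q, Q ∈ N ↔ Q ∈ centralizerOp L ∧ ∀ m : ℕ, Q.1.HasOrder m → n.gcd M ∣ m) :
    N ≤ Submodule.span (polyRing L) (Set.range fun i : Fin G.length => G.get i) := by
  intro A hA
  by_cases h0 : A = 0
  · rw [h0]; exact zero_mem _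
  obtain ⟨m, hm⟩ := exists_hasOrder h0
  -- Elements of N have unbounded order, so the descent takes place inside N instead of Z(L). All
  -- orders met are then divisible by ρ, and their class minima are within the bound.
  refine mem_of_forall_hasOrder hn hL (constSubmodule (Submodule.span (polyRing L)
    (Set.range fun i : Fin G.length => G.get i))) (constSubmodule N)
    (fun B hB => ((hN B).1 hB).1) (m + 1) ?_ hA
    (by push_cast; rw [add_sub_cancel_right]; exact hm.2)
  rintro w - ⟨B, hB, hBo⟩
  have hdvd := ((hN B).1 hB).2 w hBo
  obtain ⟨q, hq, hqw, hle⟩ := hM.exists_classMin_le hn hL hdvd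
  obtain ⟨X, hX, hXZ, hXo⟩ := h.exists_get hn hL hq hle
  obtain ⟨p, hp⟩ := exists_smul_hasOrder hL hXo
    (hq.2 w ⟨B, ((hN B).1 hB).1, hBo⟩ hqw.symm) hqw.symm
  refine ⟨p • X, Submodule.smul_mem _ p hX,
    (hN _).2 ⟨(centralizerOp L).smul_mem p hXZ, fun r hr => ?_⟩, hp⟩
  rwa [Int.ofNat_inj.1 (hr.unique hp)]

end MaximalSubmodule

/-! ### The main theorem -/

theorem mainTheorem3 {K : Type*} [Field K] [CharZero K] [Differential K]
    (S : ConstSolver K) (n M : ℕ) (hn : 0 < n) (L : DiffOp K)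
    (hL : IsNormalForm n L) (hM : IsLevel L M) :
    (n.gcd M = 1 → ∀ G : List (DiffOp K), IsFilteredBasis n L G ↔ G = filteredBasis S n L M) ∧
    (n.gcd M ≠ 1 → ∃ N : Submodule (polyRing L) (DiffOp K),
      IsBasisOf L (filteredBasis S n L M) N ∧ N ≤ centralizerOp L ∧
      (∃ N' : Submodule (polyRing L) (DiffOp K), IsMaximalOfRank n (n.gcd M) L N') ∧
      (∀ N' : Submodule (polyRing L) (DiffOp K), IsMaximalOfRank n (n.gcd M) L N' → N' ≤ N) ∧
      (∀ N' : Submodule (polyRing L) (DiffOp K),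
        (∀ Q, Q ∈ N' ↔ Q ∈ centralizerOp L ∧ ∀ m : ℕ, Q.1.HasOrder m → n.gcd M ∣ m) →
          N' ≤ N)) := by
  obtain ⟨hhead, ord, h⟩ := exists_isReducedFamily_filteredBasis S hn hL hM
  constructor
  · intro hρ G
    -- For ρ = 1 every class modulo n is a class of multiples of ρ, so no class minimum escapes the
    -- loop.
    have hb : ∀ q ∈ classMin n L, q ≤ (n / n.gcd M - 1) * M := by
      intro q hq
      obtain ⟨r, hr, hrq, hle⟩ := hM.exists_classMin_le hn hL (r := q) (by rw [hρ]; exact one_dvd q)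
      rwa [← classMin_unique hr hq hrq]
    constructor
    · intro hG
      obtain ⟨ord', h'⟩ := hG.exists_isReducedFamily hn hL ((n / n.gcd M - 1) * M)
      exact h'.eq hb h
    · rintro rfl
      exact h.isFilteredBasis hn hL hb hhead
  · intro _
    exact ⟨_, ⟨h.linearIndependent hn hL, rfl⟩, h.span_le hn hL, hM.exists_isMaximalOfRank hn hL,
      fun N' hN' => hN'.le hn hL hM h, fun N' hN' => h.le_span_of_dvd hn hL hM hN'⟩
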